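/- **Definitions.** For positive integers $N,s_1,s_2,s_3$ let $C_N(s_1,s_2,s_3)$ be the triple-loop network: the digraph on $\mathbb Z_N$ with arcs $c\to c+s_i$. A vector $a\in\mathbb N^3$ ($0\in\mathbb N$) is a *routing* to the vertex $a_1s_1+a_2s_2+a_3s_3\in\mathbb Z_N$, of length $\|a\|=a_1+a_2+a_3$. A *minimum distance diagram* (MDD) is a map $D:\mathbb Z_N\to\mathbb N^3$ such that each $D(c)$ is a routing to $c$ of minimum length and the image of $D$ is closed under passing to coordinatewise smaller vectors of $\mathbb N^3$. It is *coherent* if for some graded monomial ordering $\prec$ on $\mathbb N^3$ each $D(c)$ is the $\prec$-minimum of all routings to $c$. The *homogeneous lattice* is $$\mathcal L_0=\{a\in\mathbb Z^3:\ a_1s_1+a_2s_2+a_3s_3\equiv 0 \ (\mathrm{mod}\ N),\ a_1+a_2+a_3=0\}.$$ For $j\in\{1,2,3\}$ let $S_j=\{a\in\mathcal L_0: a_j\le 0,\ a_i\ge 0 \text{ for } i\ne j\}$; its *Hilbert basis* is the set of its non-zero elements that are not a sum of two non-zero elements of $S_j$. Write $\|a\|=\sum_i|a_i|$ on $\mathbb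 Z^3$ and $H_0=\{w\in\mathbb R^3:w_1+w_2+w_3=0\}$. The ray spanned by a non-zero $w\in H_0$ is *compatible* with $a$ and $S_j$ if: (i) $w\cdot a=0$, and $\|a\|\le\|b\|$ for every non-zero $b\in\mathcal L_0$ with $w\cdot b=0$; (ii) $a$ is in the Hilbert basis of $S_j$; (iii) $w\cdot b\ge 0$ for every $b\in S_j$ with $\|b\|\le\|a\|$. The *cone* of an MDD $D$ is the set of $w\in H_0$ such that for every vertex $c$, $D(c)$ is the only routing to $c$ of minimum weight $w\cdot a$ among the routings $a$ to $c$ of minimum length; a ray is a *boundary ray* of the fan if it is spanned by a non-zero $w$ lying in the closures of the cones of two different MDD's. **Theorem.** Let $q$ be a positive integer with $q-1$ not divisible by $3$, let $N=1+q+q^2$, and let $\mathcal L_0$ be the homogeneous lattice of $C_N(1,q,q^2)$. 1. $\mathcal L_0$ is invariant under cyclic permutation of the coordinates. Each of $S_1,S_2,S_3$ has exactly $q+2$ Hilbert basis elements; those of $S_1$ are $$(-N,0,N)\quad\text{and}\quad(-q-1,1,q)+i\,(-q,q+1,-1),\qquad i=0,\dots,q,$$ and those of $S_2$ and $S_3$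 are obtained from them by cyclic permutation of the coordinates. 2. For each $j$ and each Hilbert basis element $a$ of $S_j$ there is exactly one ray compatible with $a$ and $S_j$, except when $a$ is $(-q-1,1,q)$ or its cyclic permutation in $S_j$ (the element of smallest norm), for which there are exactly two, opposite to each other. Altogether there are exactly $3(q+2)$ different rays compatible with a Hilbert basis element of one of $S_1,S_2,S_3$. 3. Let $k>N$ and $t$ be natural numbers with $\gcd(t,k)=\gcd(k,N)=1$. Then the boundary rays of the fan of the network $C_{Nk}(t+k,\,t+qk,\,t+q^2k)$ are exactly the rays of part 2, and this network has exactly $3(q+2)$ coherent MDD's. Consequently, for every $B$ there is a triple-loop network with at least $B$ MDD's. -/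

import Mathlib

open scoped MonomialOrder

noncomputable section

namespace MultiLoop

variable {r : ℕ}

/-- The vertex of `C_N(s₁,…,s_r)` reached from `0` by a path with `a i` arcs of type `s i`. -/
def endpoint (N : ℕ) (s : Fin r → ℕ) (a : Fin r →₀ ℕ) : ZMod N :=
  ∑ i, (a i : ZMod N) * (s i : ZMod N)

/-- Minimum distance diagrams of `C_N(s₁,…,s_r)`; `Finsupp.degree` is the `L₁`-norm on `ℕ^r`. -/
structure IsMDD (N : ℕ) (s : Fin r → ℕ) (D : ZMod N → (Fin r →₀ ℕ)) : Prop where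
  endpoint_eq : ∀ c, endpoint N s (D c) = c
  degree_le : ∀ c b, endpoint N s b = c → (D c).degree ≤ b.degree
  mem_range_of_le : ∀ c b, b ≤ D c → ∃ c', D c' = b

/-- A monomial ordering is graded if it extends the partial ordering by total degree. -/
def IsGraded (m : MonomialOrder.{0, 0} (Fin r)) : Prop :=
  ∀ a b : Fin r →₀ ℕ, a.degree < b.degree → a ≺[m] b

/-- An MDD is coherent if, for some graded monomial ordering, it picks for every vertex `c` the
smallest of all the routings to `c`. -/
def IsCoherentMDD (N : ℕ) (s : Fin r → ℕ) (D : ZMod N → (Fin r →₀ ℕ)) : Prop :=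
  IsMDD N s D ∧ ∃ m : MonomialOrder.{0, 0} (Fin r), IsGraded m ∧
    ∀ c b, endpoint N s b = c → D c ≼[m] b

/-- The homogeneous lattice `𝓛₀` of `C_N(s₁,…,s_r)`. -/
def homLattice (N : ℕ) (s : Fin r → ℕ) : AddSubgroup (Fin r → ℤ) where
  carrier := {a | (N : ℤ) ∣ ∑ i, a i * (s i : ℤ) ∧ ∑ i, a i = 0}
  zero_mem' := by simp
  add_mem' := by
    rintro a b ⟨ha, ha'⟩ ⟨hb, hb'⟩
    refine ⟨?_, ?_⟩
    · simpa [add_mul, Finset.sum_add_distrib] using dvd_add ha hb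
    · simp [Finset.sum_add_distrib, ha', hb']
  neg_mem' := by
    rintro a ⟨ha, ha'⟩
    refine ⟨?_, ?_⟩
    · simpa using ha
    · simp [ha']

/-- The `L₁`-norm on `ℤ^r`. -/
def l1 (a : Fin r → ℤ) : ℤ := ∑ i, |a i|

/-- The orthant semigroup `S^ε` of a lattice. -/
def orthant (L : AddSubgroup (Fin r → ℤ)) (ε : Fin r → ℤˣ) : Set (Fin r → ℤ) :=
  {a | a ∈ L ∧ ∀ i, 0 ≤ (ε i : ℤ) * a i}

/-- The sign vector whose only negative entry is the one at `j`. -/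
def oneNeg (j : Fin r) : Fin r → ℤˣ := fun i => if i = j then -1 else 1

/-- The Hilbert basis of a semigroup `S`: its non-zero elements that are not the sum of two
non-zero elements of `S`. -/
def hilbertBasis (S : Set (Fin r → ℤ)) : Set (Fin r → ℤ) :=
  {a | a ∈ S ∧ a ≠ 0 ∧ ∀ b ∈ S, ∀ c ∈ S, a = b + c → b = 0 ∨ c = 0}

/-- The hyperplane `H₀` of weight vectors with coordinate sum zero. -/
def H0 (r : ℕ) : Submodule ℝ (Fin r → ℝ) where
  carrier := {w | ∑ i, w i = 0}
  zero_mem' := by simp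
  add_mem' := by
    intro a b ha hb
    simp only [Set.mem_ofPred_eq] at ha hb ⊢
    simp [Finset.sum_add_distrib, ha, hb]
  smul_mem' := by
    intro c a ha
    simp only [Set.mem_ofPred_eq] at ha ⊢
    simp [← Finset.mul_sum, ha]

/-- The value `w · a` of a weight vector on an integer vector. -/
def weight (w : H0 r) (a : Fin r → ℤ) : ℝ := ∑ i, w.1 i * (a i : ℝ)

/-- The value `w · a` of a weight vector on a vector of `ℕ^r`. -/
def natWeight (w : H0 r) (a : Fin r →₀ ℕ) : ℝ := ∑ i, w.1 i * (a i : ℝ)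

/-- `w` and `a` are compatible with respect to the lattice `L` and the orthant with its only
negative sign at `j`. -/
structure Compatible (L : AddSubgroup (Fin r → ℤ)) (j : Fin r) (w : H0 r)
    (a : Fin r → ℤ) : Prop where
  orthogonal : weight w a = 0
  l1_minimal : ∀ b ∈ L, b ≠ 0 → weight w b = 0 → l1 a ≤ l1 b
  mem_hilbertBasis : a ∈ hilbertBasis (orthant L (oneNeg j))
  weight_nonneg : ∀ b ∈ orthant L (oneNeg j), l1 b ≤ l1 a → 0 ≤ weight w b

/-- The rays of `H₀` spanned by a non-zero `w` compatible with `a`. -/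
def compatibleRays (L : AddSubgroup (Fin r → ℤ)) (j : Fin r) (a : Fin r → ℤ) :
    Set (Module.Ray ℝ (H0 r)) :=
  {ρ | ∃ (w : H0 r) (hw : w ≠ 0), ρ = rayOfNeZero ℝ w hw ∧ Compatible L j w a}

/-- The cone of an MDD `D`: the weight vectors `w` in `H₀` for which, at every vertex `c`, `D c` is
the only routing to `c` of minimum `w`-weight among the routings to `c` of minimum length. -/
def mddCone (N : ℕ) (s : Fin r → ℕ) (D : ZMod N → (Fin r →₀ ℕ)) : Set (H0 r) :=
  {w | IsMDD N s D ∧ ∀ c b, endpoint N s b = c → b.degree = (D c).degree → b ≠ D c →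
    natWeight w (D c) < natWeight w b}

/-- The boundary rays of the fan of MDD cones: those in the common boundary of the cones of two
different MDD's. -/
def boundaryRays (N : ℕ) (s : Fin r → ℕ) : Set (Module.Ray ℝ (H0 r)) :=
  {ρ | ∃ (w : H0 r) (hw : w ≠ 0), ρ = rayOfNeZero ℝ w hw ∧
    ∃ D D', D ≠ D' ∧ w ∈ closure (mddCone N s D) ∧ w ∈ closure (mddCone N s D')}

/-- Cyclic permutation of the three coordinates by `j` places, moving the entry at `0` to `j`. -/
def rotate (j : Fin 3) (a : Fin 3 → ℤ) : Fin 3 → ℤ := fun i => a (i - j)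

/-- `(-q-1, 1, q) + i (-q, q+1, -1)`. -/
def basisVec (q i : ℕ) : Fin 3 → ℤ :=
  ![-(q : ℤ) - 1, 1, q] + (i : ℤ) • ![-(q : ℤ), q + 1, -1]

/-- `(-N, 0, N)` for `N = 1 + q + q²`, and `(-q-1, 1, q) + i (-q, q+1, -1)` for `0 ≤ i ≤ q`. -/
def basisList (q : ℕ) : Set (Fin 3 → ℤ) :=
  {![-(1 + q + q ^ 2 : ℤ), 0, 1 + q + q ^ 2]} ∪ {a | ∃ i : ℕ, i ≤ q ∧ a = basisVec q i}

end MultiLoop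

end

/-! Write v_j for the j-th rotation of (-q-1, 1, q), indices mod 3, so v_0 + v_1 + v_2 = 0. Since q
- 1 is invertible modulo N, v_j and v_{j+1} form a basis of the homogeneous lattice; below, (α, β)
stands for α v_j + β v_{j+1}. There S_j is the cone spanned by (q+1, 1) and (1, -q), with Hilbert
basis (1, 0), (1, -1), ..., (1, -q), (q+1, 1) (`mem_hilbertBasis_iff`).

A weight w is given by its values (x, y) on v_j, v_{j+1}. Compatibility with (1, -i) means (x, y) is
a positive multiple of (i, 1) when i > 0, and x = 0 with either sign of y when i = 0. The vector
(q+1, 1) of S_j is the opposite of (1, -q) of S_{j+2} and has the same ray. So each j contributes q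
+ 2 rays.

In the network, routings of equal length to a vertex differ by the homogeneous lattice, and all
lengths to a vertex agree modulo k. Hence a routing n e_j with n < k is shortest, and its
competitors are the n e_j + b with b in S_j and -b_j ≤ n. As -a_j ≤ N < k on Hilbert bases, these
routings let a diagram detect Hilbert basis elements. A compatible w therefore has two tie-breakings
with different diagrams (`mem_boundaryRays`), and a tie between two optimal routings yields a
compatible element (`exists_compatible`).

Coherent diagrams are counted through the signs a graded order gives to lattice vectors. These fall
into 3(q + 2) types (`exists_hasType`), all realized (`exists_isGraded_hasType`); a type determines
the diagram (`eq_of_hasType`) and conversely (`hasType_unique`). -/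

noncomputable section

namespace MultiLoop

/-! ### Coordinates on the homogeneous lattice and the Hilbert bases. -/

section

/-- The homogeneous lattice of `C_N(1, q, q²)` for `N = 1 + q + q²`. -/
abbrev lat (q : ℕ) : AddSubgroup (Fin 3 → ℤ) := homLattice (1 + q + q ^ 2) ![1, q, q ^ 2]

/-- The combination `α v + β v'` of `v = rotate j (basisVec q 0)` and its rotation `v'`. -/
def latVec (q : ℕ) (j : Fin 3) (α β : ℤ) : Fin 3 → ℤ :=
  rotate j ![-(q + 1) * α + q * β, α - (q + 1) * β, q * α + β]

variable {q : ℕ}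

lemma forall_fin_three {j : Fin 3} {P : Fin 3 → Prop} :
    (∀ i, P i) ↔ P j ∧ P (j + 1) ∧ P (j + 2) := by
  constructor
  · exact fun h => ⟨h _, h _, h _⟩
  · rintro ⟨h0, h1, h2⟩ i
    obtain rfl | rfl | rfl : i = j ∨ i = j + 1 ∨ i = j + 2 := by clear h0 h1 h2; revert i j; decide
    all_goals assumption

lemma sum_fin_three {M : Type*} [AddCommMonoid M] (j : Fin 3) (f : Fin 3 → M) :
    ∑ i, f i = f j + f (j + 1) + f (j + 2) := by
  have h : (Finset.univ : Finset (Fin 3)) = {j, j + 1, j + 2} := by revert j; decide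
  rw [h, Finset.sum_insert (by revert j; decide), Finset.sum_pair (by revert j; decide), add_assoc]

lemma latVec_self (j : Fin 3) (α β : ℤ) : latVec q j α β j = -(q + 1) * α + q * β := by
  simp [latVec, rotate]

lemma latVec_add_one (j : Fin 3) (α β : ℤ) : latVec q j α β (j + 1) = α - (q + 1) * β := by
  simp [latVec, rotate]

lemma latVec_add_two (j : Fin 3) (α β : ℤ) : latVec q j α β (j + 2) = q * α + β := by
  simp [latVec, rotate]

lemma eq_latVec_iff {j : Fin 3} {a : Fin 3 → ℤ} {α β : ℤ} : a = latVec q j α β ↔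
    a j = -(q + 1) * α + q * β ∧ a (j + 1) = α - (q + 1) * β ∧ a (j + 2) = q * α + β := by
  rw [funext_iff, forall_fin_three (j := j), latVec_self, latVec_add_one, latVec_add_two]

lemma latVec_add (j : Fin 3) (α β α' β' : ℤ) :
    latVec q j α β + latVec q j α' β' = latVec q j (α + α') (β + β') := by
  rw [eq_latVec_iff]
  simp only [Pi.add_apply, latVec_self, latVec_add_one, latVec_add_two]
  exact ⟨by ring, by ring, by ring⟩

lemma latVec_sub (j : Fin 3) (α β α' β' : ℤ) :
    latVec q j α β - latVec q j α' β' = latVec q j (α - α') (β - β') := by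
  rw [eq_latVec_iff]
  simp only [Pi.sub_apply, latVec_self, latVec_add_one, latVec_add_two]
  exact ⟨by ring, by ring, by ring⟩

lemma latVec_neg (j : Fin 3) (α β : ℤ) : -latVec q j α β = latVec q j (-α) (-β) := by
  rw [eq_latVec_iff]
  simp only [Pi.neg_apply, latVec_self, latVec_add_one, latVec_add_two]
  exact ⟨by ring, by ring, by ring⟩

lemma latVec_zero (j : Fin 3) : latVec q j 0 0 = 0 := by
  symm
  rw [eq_latVec_iff]
  simp

lemma latVec_inj (j : Fin 3) {α β α' β' : ℤ} (h : latVec q j α β = latVec q j α' β') :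
    α = α' ∧ β = β' := by
  obtain ⟨-, h1, h2⟩ := eq_latVec_iff.1 h
  rw [latVec_add_one] at h1
  rw [latVec_add_two] at h2
  have hα : (1 + q + q ^ 2 : ℤ) * α = (1 + q + q ^ 2) * α' := by
    linear_combination h1 + (q + 1) * h2
  have hα' : α = α' := mul_left_cancel₀ (by positivity) hα
  exact ⟨hα', by subst hα'; linarith⟩

lemma latVec_eq_zero (j : Fin 3) {α β : ℤ} : latVec q j α β = 0 ↔ α = 0 ∧ β = 0 := by
  constructor
  · intro h
    rw [← latVec_zero (q := q) j] at h
    exact latVec_inj j h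
  · rintro ⟨rfl, rfl⟩
    exact latVec_zero j

/-- The change of basis given by a cyclic permutation of the coordinates. -/
lemma latVec_succ (j : Fin 3) (α β : ℤ) :
    latVec q (j + 1) α β = latVec q j (-β) (α - β) := by
  rw [eq_latVec_iff]
  have h1 : j = (j + 1) + 2 := by revert j; decide
  have h2 : j + 2 = (j + 1) + 1 := by revert j; decide
  refine ⟨?_, ?_, ?_⟩
  · have := latVec_add_two (q := q) (j + 1) α β
    rw [← h1] at this
    rw [this]; ring
  · rw [latVec_self]; ring
  · rw [h2, latVec_add_one]; ring

lemma exists_latVec_succ (j : Fin 3) (α β : ℤ) :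
    ∃ α' β', latVec q j α β = latVec q (j + 1) α' β' :=
  ⟨β - α, -α, by rw [latVec_succ]; congr 1 <;> ring⟩

lemma exists_latVec (i j : Fin 3) (α β : ℤ) :
    ∃ α' β', latVec q i α β = latVec q j α' β' := by
  obtain ⟨α₁, β₁, h₁⟩ := exists_latVec_succ (q := q) i α β
  obtain ⟨α₂, β₂, h₂⟩ := exists_latVec_succ (q := q) (i + 1) α₁ β₁
  obtain rfl | rfl | rfl : j = i ∨ j = i + 1 ∨ j = i + 1 + 1 := by
    clear h₁ h₂; revert i j; decide
  exacts [⟨α, β, rfl⟩, ⟨α₁, β₁, h₁⟩, ⟨α₂, β₂, h₁.trans h₂⟩]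

lemma isCoprime_sub_one (hq : ¬ (3 : ℤ) ∣ (q : ℤ) - 1) :
    IsCoprime ((q : ℤ) - 1) (1 + q + q ^ 2) := by
  have h3 : IsCoprime ((q : ℤ) - 1) 3 :=
    ((Int.prime_three.coprime_iff_not_dvd).2 hq).symm
  have : (1 + q + q ^ 2 : ℤ) = 3 + (q - 1) * (q + 2) := by ring
  rw [this]
  exact h3.add_mul_left_right _

/-- Eliminating a_0 turns the congruence into N ∣ (q - 1)(a_1 + (q + 1) a_2). Cancelling q - 1 gives
α as the remaining quotient, and β is read off a_2. -/
lemma mem_lat_iff (hq : ¬ (3 : ℤ) ∣ (q : ℤ) - 1) (j : Fin 3) {a : Fin 3 → ℤ} :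
    a ∈ lat q ↔ ∃ α β, a = latVec q j α β := by
  have key : a ∈ lat q ↔ ∃ α β, a = latVec q 0 α β := by
    have hmem : a ∈ lat q ↔ ((1 + q + q ^ 2 : ℕ) : ℤ) ∣ a 0 + a 1 * q + a 2 * q ^ 2 ∧
        a 0 + a 1 + a 2 = 0 := by
      simp only [lat, homLattice, ← SetLike.mem_coe, AddSubgroup.coe_set_mk, AddSubmonoid.coe_set_mk,
        AddSubsemigroup.coe_set_mk, Set.mem_ofPred_eq, Fin.sum_univ_three]
      simp
    rw [hmem]
    push_cast
    constructor
    · rintro ⟨h, h0⟩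
      have h' : (1 + q + q ^ 2 : ℤ) ∣ (q - 1) * (a 1 + (q + 1) * a 2) := by
        convert h using 1
        linear_combination (-1 : ℤ) * h0
      obtain ⟨α, hα⟩ := (isCoprime_sub_one hq).symm.dvd_of_dvd_mul_left h'
      refine ⟨α, a 2 - q * α, eq_latVec_iff.2 ⟨?_, ?_, ?_⟩⟩
      · show a 0 = _
        linear_combination h0 - hα
      · show a 1 = _
        linear_combination hα
      · show a 2 = _
        ring
    · rintro ⟨α, β, h⟩
      obtain ⟨h0, h1, h2⟩ := eq_latVec_iff.1 h
      simp only [zero_add] at h1 h2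
      rw [h0, h1, h2]
      exact ⟨⟨(q - 1) * α, by ring⟩, by ring⟩
  rw [key]
  constructor <;> rintro ⟨α, β, rfl⟩ <;> exact exists_latVec _ _ _ _

lemma latVec_mem (hq : ¬ (3 : ℤ) ∣ (q : ℤ) - 1) (j : Fin 3) (α β : ℤ) :
    latVec q j α β ∈ lat q := (mem_lat_iff hq j).2 ⟨α, β, rfl⟩

lemma rotate_latVec (j : Fin 3) (α β : ℤ) : rotate j (latVec q 0 α β) = latVec q j α β := by
  funext i
  simp [latVec, rotate]

lemma rotate_rotate (i j : Fin 3) (a : Fin 3 → ℤ) : rotate i (rotate j a) = rotate (i + j) a := by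
  funext l
  simp [rotate, sub_sub]

lemma rotate_mem_lat_iff (hq : ¬ (3 : ℤ) ∣ (q : ℤ) - 1) (j : Fin 3) (a : Fin 3 → ℤ) :
    rotate j a ∈ lat q ↔ a ∈ lat q := by
  have h : ∀ (j : Fin 3) (a : Fin 3 → ℤ), a ∈ lat q → rotate j a ∈ lat q := by
    intro j a ha
    obtain ⟨α, β, rfl⟩ := (mem_lat_iff hq 0).1 ha
    rw [rotate_latVec]
    exact latVec_mem hq _ _ _
  refine ⟨fun ha => ?_, h j a⟩
  have := h (-j) _ ha
  rw [rotate_rotate] at this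
  convert this
  funext l
  simp [rotate]

lemma rotate_basisVec (j : Fin 3) (i : ℕ) : rotate j (basisVec q i) = latVec q j 1 (-i) := by
  rw [← rotate_latVec]
  congr 1
  rw [eq_latVec_iff]
  simp [basisVec]
  exact ⟨by ring, by ring⟩

lemma rotate_longVec (j : Fin 3) :
    rotate j ![-(1 + q + q ^ 2 : ℤ), 0, 1 + q + q ^ 2] = latVec q j (q + 1) 1 := by
  rw [← rotate_latVec]
  congr 1
  rw [eq_latVec_iff]
  simp
  exact ⟨by ring, by ring⟩

lemma mem_orthant_iff {L : AddSubgroup (Fin 3 → ℤ)} {j : Fin 3} {a : Fin 3 → ℤ} :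
    a ∈ orthant L (oneNeg j) ↔ a ∈ L ∧ a j ≤ 0 ∧ 0 ≤ a (j + 1) ∧ 0 ≤ a (j + 2) := by
  have h1 : j + 1 ≠ j := by revert j; decide
  have h2 : j + 2 ≠ j := by revert j; decide
  simp only [orthant, Set.mem_ofPred_eq]
  rw [forall_fin_three (j := j)]
  simp [oneNeg, h1, h2]

lemma sum_eq_zero_of_mem {N : ℕ} {s : Fin 3 → ℕ} {a : Fin 3 → ℤ} (ha : a ∈ homLattice N s)
    (j : Fin 3) : a j + a (j + 1) + a (j + 2) = 0 := by
  rw [← sum_fin_three]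
  exact ha.2

lemma latVec_mem_orthant_iff (hq : ¬ (3 : ℤ) ∣ (q : ℤ) - 1) {j : Fin 3} {α β : ℤ} :
    latVec q j α β ∈ orthant (lat q) (oneNeg j) ↔
      0 ≤ α - (q + 1) * β ∧ 0 ≤ q * α + β := by
  rw [mem_orthant_iff, latVec_self, latVec_add_one, latVec_add_two]
  refine ⟨fun h => h.2.2, fun h => ⟨latVec_mem hq _ _ _, ?_, h⟩⟩
  linarith [h.1, h.2]

lemma l1_eq_of_mem_orthant {N : ℕ} {s : Fin 3 → ℕ} {j : Fin 3} {a : Fin 3 → ℤ}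
    (ha : a ∈ orthant (homLattice N s) (oneNeg j)) : l1 a = -2 * a j := by
  obtain ⟨ha, h0, h1, h2⟩ := mem_orthant_iff.1 ha
  have := sum_eq_zero_of_mem ha j
  rw [l1, sum_fin_three j, abs_of_nonpos h0, abs_of_nonneg h1, abs_of_nonneg h2]
  linarith

/-- N α = (α - (q+1)β) + (q+1)(qα + β). Thus α is an additive function on S_j, positive on its
non-zero elements. -/
lemma coeff_pos {α β : ℤ} (h1 : 0 ≤ α - (q + 1) * β) (h2 : 0 ≤ q * α + β) :
    0 < α ∨ (α = 0 ∧ β = 0) := by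
  have h : 0 ≤ (1 + q + q ^ 2 : ℤ) * α := by nlinarith
  have h0 : 0 ≤ α := nonneg_of_mul_nonneg_right h (by positivity)
  rcases h0.lt_or_eq with h0 | h0
  · exact Or.inl h0
  · subst h0
    refine Or.inr ⟨rfl, ?_⟩
    rcases lt_trichotomy β 0 with hb | hb | hb
    · linarith
    · exact hb
    · nlinarith

/-- Here (q+1)α - qβ is half the norm, with value q + 1 + iq at (1, -i); the lemma supplies
condition (iii) for the weight (i, 1). If iα + β ≤ -1, half the norm is at least (q + 1 + iq)α + q,
which is too large. -/
lemma mul_add_nonneg_of_le (hq0 : 0 < q) {α β : ℤ} (i : ℕ) (hα : 0 < α)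
    (hle : (q + 1) * α - q * β ≤ q + 1 + i * q) : 0 ≤ i * α + β := by
  by_contra hneg
  push Not at hneg
  have hq0' : (0 : ℤ) < q := by exact_mod_cast hq0
  have h6 : (q : ℤ) * (i * α + β + 1) ≤ 0 :=
    mul_nonpos_of_nonneg_of_nonpos hq0'.le (by linarith)
  have h7 : (0 : ℤ) ≤ q * i * (α - 1) := mul_nonneg (by positivity) (by linarith)
  have h8 : (0 : ℤ) ≤ q * (α - 1) := mul_nonneg (by positivity) (by linarith)
  nlinarith

/-- If β ≥ 1, then α ≥ (q+1)β makes half the norm at least Nβ > q + 1. -/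
lemma eq_zero_of_short (hq0 : 0 < q) {α β : ℤ} (hα : 0 < α) (h1 : 0 ≤ α - (q + 1) * β)
    (hle : (q + 1) * α - q * β ≤ q + 1) : β = 0 := by
  apply le_antisymm _ (by simpa using mul_add_nonneg_of_le hq0 0 hα (by simpa using hle))
  by_contra hβ
  push Not at hβ
  have : (0 : ℤ) ≤ (q + 1) * (α - (q + 1) * β) := mul_nonneg (by positivity) h1
  have h9 : (0 : ℤ) ≤ (1 + q + q ^ 2) * (β - 1) := mul_nonneg (by positivity) (by linarith)
  nlinarith

lemma latVec_one_mem_orthant (hq : ¬ (3 : ℤ) ∣ (q : ℤ) - 1) (j : Fin 3) {i : ℕ} (hi : i ≤ q) :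
    latVec q j 1 (-i) ∈ orthant (lat q) (oneNeg j) := by
  rw [latVec_mem_orthant_iff hq]
  have : (i : ℤ) ≤ q := by exact_mod_cast hi
  constructor
  · have : (0 : ℤ) ≤ (q + 1) * i := by positivity
    linarith
  · linarith

lemma latVec_long_mem_orthant (hq : ¬ (3 : ℤ) ∣ (q : ℤ) - 1) (j : Fin 3) :
    latVec q j (q + 1) 1 ∈ orthant (lat q) (oneNeg j) := by
  rw [latVec_mem_orthant_iff hq]
  exact ⟨by linarith, by positivity⟩

/-- Every non-zero element of an octant semigroup dominates one of the listed elements. -/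
lemma exists_basis_le (hq : ¬ (3 : ℤ) ∣ (q : ℤ) - 1) {j : Fin 3} {a : Fin 3 → ℤ}
    (ha : a ∈ orthant (lat q) (oneNeg j)) (h0 : a ≠ 0) :
    ∃ b ∈ orthant (lat q) (oneNeg j), b ≠ 0 ∧ a - b ∈ orthant (lat q) (oneNeg j) ∧
      ((∃ i : ℕ, i ≤ q ∧ b = latVec q j 1 (-i)) ∨ b = latVec q j (q + 1) 1) := by
  obtain ⟨α, β, rfl⟩ := (mem_lat_iff hq j).1 ha.1
  have ha' := (latVec_mem_orthant_iff hq).1 ha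
  rw [ne_eq, latVec_eq_zero] at h0
  have hα : 0 < α := (coeff_pos ha'.1 ha'.2).resolve_right h0
  rcases le_or_gt β 0 with hβ | hβ
  · obtain ⟨m, rfl⟩ : ∃ m : ℕ, β = -m := ⟨(-β).toNat, by omega⟩
    have hmin : ((min m q : ℕ) : ℤ) ≤ q := by simp
    have hmin' : ((min m q : ℕ) : ℤ) ≤ m := by simp
    -- The cap q is the largest i for which (1, -i) still satisfies qα + β ≥ 0.
    refine ⟨latVec q j 1 (-(min m q : ℕ)), latVec_one_mem_orthant hq j (min_le_right _ _), ?_, ?_,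
      Or.inl ⟨_, min_le_right _ _, rfl⟩⟩
    · rw [ne_eq, latVec_eq_zero]; simp
    · rw [latVec_sub, latVec_mem_orthant_iff hq]
      constructor
      · have : (0 : ℤ) ≤ (q + 1) * (m - (min m q : ℕ)) :=
          mul_nonneg (by positivity) (by linarith)
        linarith
      · rcases le_total m q with h | h
        · rw [min_eq_left h]
          have : (0 : ℤ) ≤ q * (α - 1) := mul_nonneg (by positivity) (by linarith)
          linarith
        · rw [min_eq_right h]
          linarith [ha'.2]
  -- Now β ≥ 1 forces α ≥ q + 1, which leaves room to subtract (q+1, 1).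
  · refine ⟨_, latVec_long_mem_orthant hq j, ?_, ?_, Or.inr rfl⟩
    · rw [ne_eq, latVec_eq_zero]; simp
    · rw [latVec_sub, latVec_mem_orthant_iff hq]
      have h1 : (0 : ℤ) ≤ (q + 1) * (β - 1) := mul_nonneg (by positivity) (by linarith)
      have h2 : (0 : ℤ) ≤ α - (q + 1) := by linarith [ha'.1]
      refine ⟨by linarith [ha'.1], ?_⟩
      have : (0 : ℤ) ≤ q * (α - (q + 1)) := by positivity
      linarith

lemma mem_hilbertBasis_iff (hq : ¬ (3 : ℤ) ∣ (q : ℤ) - 1) {j : Fin 3} {a : Fin 3 → ℤ} :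
    a ∈ hilbertBasis (orthant (lat q) (oneNeg j)) ↔
      (∃ i : ℕ, i ≤ q ∧ a = latVec q j 1 (-i)) ∨ a = latVec q j (q + 1) 1 := by
  constructor
  · rintro ⟨ha, h0, hirr⟩
    obtain ⟨b, hb, hb0, hab, hlist⟩ := exists_basis_le hq ha h0
    have := (hirr b hb (a - b) hab (by abel)).resolve_left hb0
    rwa [sub_eq_zero.1 this]
  · intro h
    have hmem : a ∈ orthant (lat q) (oneNeg j) := by
      rcases h with ⟨i, hi, rfl⟩ | rfl
      · exact latVec_one_mem_orthant hq j hi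
      · exact latVec_long_mem_orthant hq j
    have hne : a ≠ 0 := by
      rcases h with ⟨i, hi, rfl⟩ | rfl <;> rw [ne_eq, latVec_eq_zero] <;> simp
    refine ⟨hmem, hne, ?_⟩
    intro b hb c hc habc
    obtain ⟨α, β, rfl⟩ := (mem_lat_iff hq j).1 hb.1
    obtain ⟨α', β', rfl⟩ := (mem_lat_iff hq j).1 hc.1
    rw [latVec_mem_orthant_iff hq] at hb hc
    rw [latVec_add] at habc
    rw [latVec_eq_zero, latVec_eq_zero]
    rcases coeff_pos hb.1 hb.2 with h1 | h1
    swap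
    · exact Or.inl h1
    rcases coeff_pos hc.1 hc.2 with h2 | h2
    swap
    · exact Or.inr h2
    -- Both summands have α ≥ 1, so α = 1 cannot split. For (q+1, 1) one summand has β ≥ 1, hence
    -- already α ≥ q + 1.
    exfalso
    rcases h with ⟨i, hi, rfl⟩ | rfl
    · have := (latVec_inj j habc).1
      omega
    · obtain ⟨h3, h4⟩ := latVec_inj j habc
      rcases le_or_gt β 0 with h5 | h5
      · have : (0 : ℤ) ≤ (q + 1) * (β' - 1) := mul_nonneg (by positivity) (by linarith)
        linarith [hc.1]
      · have : (0 : ℤ) ≤ (q + 1) * (β - 1) := mul_nonneg (by positivity) (by linarith)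
        linarith [hb.1]

lemma mem_rotate_basisList_iff {j : Fin 3} {a : Fin 3 → ℤ} :
    a ∈ rotate j '' basisList q ↔
      (∃ i : ℕ, i ≤ q ∧ a = latVec q j 1 (-i)) ∨ a = latVec q j (q + 1) 1 := by
  constructor
  · rintro ⟨b, rfl | ⟨i, hi, rfl⟩, rfl⟩
    · exact Or.inr (rotate_longVec j)
    · exact Or.inl ⟨i, hi, rotate_basisVec j i⟩
  · rintro (⟨i, hi, rfl⟩ | rfl)
    · exact ⟨_, Or.inr ⟨i, hi, rfl⟩, rotate_basisVec j i⟩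
    · exact ⟨_, Or.inl rfl, rotate_longVec j⟩

lemma hilbertBasis_eq (hq : ¬ (3 : ℤ) ∣ (q : ℤ) - 1) (j : Fin 3) :
    hilbertBasis (orthant (lat q) (oneNeg j)) = rotate j '' basisList q := by
  ext a
  rw [mem_hilbertBasis_iff hq, mem_rotate_basisList_iff]

lemma ncard_hilbertBasis (hq : ¬ (3 : ℤ) ∣ (q : ℤ) - 1) (j : Fin 3) :
    (hilbertBasis (orthant (lat q) (oneNeg j))).ncard = q + 2 := by
  have h : hilbertBasis (orthant (lat q) (oneNeg j)) =
      insert (latVec q j (q + 1) 1)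
        ((fun i : ℕ => latVec q j 1 (-i)) '' (Finset.range (q + 1) : Set ℕ)) := by
    ext a
    rw [mem_hilbertBasis_iff hq]
    simp only [Set.mem_insert_iff, Set.mem_image, Finset.coe_range, Set.mem_Iio, Nat.lt_succ_iff,
      or_comm, eq_comm]
  rw [h, Set.ncard_insert_of_notMem, Set.InjOn.ncard_image, Set.ncard_coe_finset,
    Finset.card_range]
  · intro i _ i' _ hi
    have := (latVec_inj j hi).2
    omega
  · rintro ⟨i, _, hi⟩
    have := (latVec_inj j hi).2
    omega

end

/-! ### Compatible rays. -/

section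

variable {q : ℕ}

lemma weight_add {r : ℕ} (w : H0 r) (a b : Fin r → ℤ) :
    weight w (a + b) = weight w a + weight w b := by
  simp [weight, mul_add, Finset.sum_add_distrib]

lemma weight_neg {r : ℕ} (w : H0 r) (a : Fin r → ℤ) : weight w (-a) = -weight w a := by
  simp [weight]

lemma weight_smul {r : ℕ} (c : ℝ) (w : H0 r) (a : Fin r → ℤ) :
    weight (c • w) a = c * weight w a := by
  simp [weight, Finset.mul_sum, mul_assoc]

lemma weight_add_left {r : ℕ} (w u : H0 r) (a : Fin r → ℤ) :
    weight (w + u) a = weight w a + weight u a := by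
  simp [weight, add_mul, Finset.sum_add_distrib]

lemma weight_neg_left {r : ℕ} (w : H0 r) (a : Fin r → ℤ) : weight (-w) a = -weight w a := by
  simp [weight]

lemma l1_neg {r : ℕ} (a : Fin r → ℤ) : l1 (-a) = l1 a := by
  simp [l1]

/-- The weight of `rotate j (basisVec q 0)`. -/
def latWeight (q : ℕ) (w : H0 3) (j : Fin 3) : ℝ := weight w (latVec q j 1 0)

lemma weight_latVec (w : H0 3) (j : Fin 3) (α β : ℤ) :
    weight w (latVec q j α β) = α * latWeight q w j + β * latWeight q w (j + 1) := by
  rw [latWeight, latWeight, latVec_succ]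
  simp only [weight, sum_fin_three j, latVec_self, latVec_add_one, latVec_add_two]
  push_cast
  ring

lemma latWeight_add_two (w : H0 3) (j : Fin 3) :
    latWeight q w (j + 2) = -latWeight q w j - latWeight q w (j + 1) := by
  have h : j + 2 = j + 1 + 1 := by revert j; decide
  rw [h, latWeight, latVec_succ, latVec_succ, weight_latVec]
  push_cast
  ring

lemma latWeight_smul (c : ℝ) (w : H0 3) (j : Fin 3) :
    latWeight q (c • w) j = c * latWeight q w j := weight_smul _ _ _

lemma latWeight_neg (w : H0 3) (j : Fin 3) : latWeight q (-w) j = -latWeight q w j :=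
  weight_neg_left _ _

lemma sum_weight_eq_zero (w : H0 3) (j : Fin 3) : w.1 j + w.1 (j + 1) + w.1 (j + 2) = 0 := by
  rw [← sum_fin_three]
  exact w.2

/-- The vectors v_j, v_{j+1} and (1, 1, 1) have determinant 3N up to sign; the linear combinations
in the proof are Cramer's rule. -/
lemma eq_smul_of_latWeight {w w' : H0 3} {c : ℝ} (j : Fin 3)
    (h : latWeight q w j = c * latWeight q w' j)
    (h' : latWeight q w (j + 1) = c * latWeight q w' (j + 1)) : w = c • w' := by
  rw [latWeight, latWeight] at h'
  rw [latVec_succ] at h'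
  simp only [latWeight, weight, sum_fin_three j, latVec_self, latVec_add_one, latVec_add_two]
    at h h'
  push_cast at h h'
  have hw := sum_weight_eq_zero w j
  have hw' := sum_weight_eq_zero w' j
  have hN : (3 * (1 + q + q ^ 2) : ℝ) ≠ 0 := by positivity
  have h2 : w.1 (j + 2) = c * w'.1 (j + 2) := by
    apply mul_left_cancel₀ hN
    linear_combination (2 * q + 1 : ℝ) * h + (q + 2) * h' + (1 + q + q ^ 2 : ℝ) * (hw - c * hw')
  have h1 : w.1 (j + 1) = c * w'.1 (j + 1) := by
    apply mul_left_cancel₀ hN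
    linear_combination (1 - q : ℝ) * h - (2 * q + 1) * h' + (1 + q + q ^ 2 : ℝ) * (hw - c * hw')
  have h0 : w.1 j = c * w'.1 j := by linear_combination hw - c * hw' - h1 - h2
  apply Subtype.ext
  funext i
  revert i
  rw [forall_fin_three (j := j)]
  exact ⟨h0, h1, h2⟩

lemma latWeight_zero (j : Fin 3) : latWeight q 0 j = 0 := by
  simp [latWeight, weight]

lemma eq_zero_of_latWeight {w : H0 3} (j : Fin 3) (h : latWeight q w j = 0)
    (h' : latWeight q w (j + 1) = 0) : w = 0 := by
  have := eq_smul_of_latWeight (q := q) (w := w) (w' := 0) (c := 0) j (by simpa using h)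
    (by simpa using h')
  simpa using this

lemma exists_latWeight (q : ℕ) (j : Fin 3) (x y : ℝ) :
    ∃ w : H0 3, latWeight q w j = x ∧ latWeight q w (j + 1) = y := by
  -- As v_j · v_j = 2N and v_j · v_{j+1} = -N, these coefficients invert the Gram matrix.
  let A : ℝ := (2 * x + y) / (3 * (1 + q + q ^ 2))
  let B : ℝ := (x + 2 * y) / (3 * (1 + q + q ^ 2))
  let f : Fin 3 → ℝ := fun i => A * (latVec q j 1 0 i : ℝ) + B * (latVec q j 0 1 i : ℝ)
  have hf : f ∈ H0 3 := by
    show ∑ i, f i = 0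
    simp only [sum_fin_three j, f, latVec_self, latVec_add_one, latVec_add_two]
    push_cast
    ring
  have hN : (1 + q + q ^ 2 : ℝ) ≠ 0 := by positivity
  refine ⟨⟨f, hf⟩, ?_, ?_⟩
  · simp only [latWeight, weight, sum_fin_three j, f, latVec_self, latVec_add_one, latVec_add_two]
    push_cast
    simp only [A, B]
    field_simp
    ring
  · rw [latWeight, latVec_succ]
    simp only [weight, sum_fin_three j, f, latVec_self, latVec_add_one, latVec_add_two]
    push_cast
    simp only [A, B]
    field_simp
    ring

/-- Two vectors orthogonal to `(1, 1, 1)` and to the same `w` are parallel. -/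
lemma mul_eq_mul_of_weight_eq_zero {w : H0 3} (hw : w ≠ 0) {a b : Fin 3 → ℤ}
    (ha : ∑ i, a i = 0) (hb : ∑ i, b i = 0) (hwa : weight w a = 0) (hwb : weight w b = 0)
    (i j : Fin 3) : a i * b j = a j * b i := by
  rw [Fin.sum_univ_three] at ha hb
  simp only [weight, Fin.sum_univ_three] at hwa hwb
  have hw0 : w.1 0 + w.1 1 + w.1 2 = 0 := sum_weight_eq_zero w 0
  have ha' : (a 0 + a 1 + a 2 : ℝ) = 0 := by exact_mod_cast ha
  have hb' : (b 0 + b 1 + b 2 : ℝ) = 0 := by exact_mod_cast hb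
  have key : a 0 * b 1 = a 1 * b 0 := by
    have h1 : (w.1 0 - w.1 2) * (a 0 * b 1 - a 1 * b 0 : ℝ) = 0 := by
      linear_combination (b 1 : ℝ) * (hwa - w.1 2 * ha') - (a 1 : ℝ) * (hwb - w.1 2 * hb')
    have h2 : (w.1 1 - w.1 2) * (a 0 * b 1 - a 1 * b 0 : ℝ) = 0 := by
      linear_combination (-(b 0 : ℝ)) * (hwa - w.1 2 * ha') + (a 0 : ℝ) * (hwb - w.1 2 * hb')
    have h3 : (a 0 * b 1 - a 1 * b 0 : ℝ) = 0 := by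
      by_contra h
      have h1' := (mul_eq_zero.1 h1).resolve_right h
      have h2' := (mul_eq_zero.1 h2).resolve_right h
      apply hw
      apply Subtype.ext
      funext i
      revert i
      rw [forall_fin_three (j := 0)]
      exact ⟨show w.1 0 = 0 by linarith, show w.1 1 = 0 by linarith, show w.1 2 = 0 by linarith⟩
    have h4 : (a 0 * b 1 : ℝ) = a 1 * b 0 := by linarith
    exact_mod_cast h4
  have e2 : a 2 = -a 0 - a 1 := by linarith
  have f2 : b 2 = -b 0 - b 1 := by linarith
  fin_cases i <;> fin_cases j <;> simp [e2, f2] <;> linarith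

/-- A lattice vector parallel to an element of an octant is in the same octant if it has the same
sign. -/
lemma mem_orthant_of_parallel {N : ℕ} {s : Fin 3 → ℕ} {j : Fin 3} {a b : Fin 3 → ℤ}
    (ha : a ∈ orthant (homLattice N s) (oneNeg j)) (ha0 : a ≠ 0) (hb : b ∈ homLattice N s)
    (hab : ∀ i l, a i * b l = a l * b i) (hle : b j ≤ 0) :
    b ∈ orthant (homLattice N s) (oneNeg j) := by
  obtain ⟨ha, h0, h1, h2⟩ := mem_orthant_iff.1 ha
  have hs := sum_eq_zero_of_mem ha j
  have h0' : a j < 0 := by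
    refine lt_of_le_of_ne h0 fun h => ha0 ?_
    funext i
    revert i
    rw [forall_fin_three (j := j)]
    exact ⟨h, show a (j + 1) = 0 by linarith, show a (j + 2) = 0 by linarith⟩
  refine mem_orthant_iff.2 ⟨hb, hle, ?_, ?_⟩
  · have := hab j (j + 1)
    by_contra h
    push Not at h
    nlinarith
  · have := hab j (j + 2)
    by_contra h
    push Not at h
    nlinarith

lemma eq_zero_of_mem_orthant {N : ℕ} {s : Fin 3 → ℕ} {j : Fin 3} {a : Fin 3 → ℤ}
    (ha : a ∈ orthant (homLattice N s) (oneNeg j)) (h : 0 ≤ a j) : a = 0 := by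
  obtain ⟨ha, h0, h1, h2⟩ := mem_orthant_iff.1 ha
  have hs := sum_eq_zero_of_mem ha j
  funext i
  revert i
  rw [forall_fin_three (j := j)]
  exact ⟨show a j = 0 by linarith, show a (j + 1) = 0 by linarith, show a (j + 2) = 0 by linarith⟩

lemma exists_pm_nonpos (b : Fin 3 → ℤ) (j : Fin 3) : b j ≤ 0 ∨ (-b) j ≤ 0 := by
  rcases le_total (b j) 0 with h | h
  · exact Or.inl h
  · exact Or.inr (by simpa using h)

/-- An element of a Hilbert basis is the shortest lattice vector on its line. -/
lemma l1_le_of_mem_hilbertBasis {N : ℕ} {s : Fin 3 → ℕ} {j : Fin 3} {a : Fin 3 → ℤ} {w : H0 3}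
    (hw : w ≠ 0) (ha : a ∈ hilbertBasis (orthant (homLattice N s) (oneNeg j)))
    (hwa : weight w a = 0) {b : Fin 3 → ℤ} (hb : b ∈ homLattice N s) (hb0 : b ≠ 0)
    (hwb : weight w b = 0) : l1 a ≤ l1 b := by
  wlog hle : b j ≤ 0 generalizing b
  · rw [← l1_neg b]
    exact this (neg_mem hb) (neg_ne_zero.2 hb0) (by rw [weight_neg, hwb, neg_zero])
      ((exists_pm_nonpos b j).resolve_left hle)
  have hpar := mul_eq_mul_of_weight_eq_zero hw ha.1.1.2 hb.2 hwa hwb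
  have hbS := mem_orthant_of_parallel ha.1 ha.2.1 hb hpar hle
  by_contra hlt
  push Not at hlt
  rw [l1_eq_of_mem_orthant ha.1, l1_eq_of_mem_orthant hbS] at hlt
  -- Both b and a - b lie on the half-line of a, hence in S_j, so a shorter b would decompose a.
  have hcS : a - b ∈ orthant (homLattice N s) (oneNeg j) := by
    refine mem_orthant_of_parallel ha.1 ha.2.1 (sub_mem ha.1.1 hb) (fun i l => ?_) ?_
    · simp only [Pi.sub_apply, mul_sub, hpar i l]
      ring
    · simp only [Pi.sub_apply]
      linarith
  rcases ha.2.2 b hbS (a - b) hcS (by abel) with h | h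
  · exact hb0 h
  · rw [sub_eq_zero.1 h] at hlt
    exact lt_irrefl _ hlt

/-- The weights of the compatible rays on `rotate j (basisVec q 0)` and its rotation: they are
`(i, 1)` for `i ≤ q` and `(0, -1)` for `i = q + 1`. -/
def rayCoord (q i : ℕ) : ℝ × ℝ := if i ≤ q then (i, 1) else (0, -1)

/-- The weight vectors spanning the compatible rays. -/
def rayVec (q : ℕ) (j : Fin 3) (i : ℕ) : H0 3 :=
  (exists_latWeight q j (rayCoord q i).1 (rayCoord q i).2).choose

lemma latWeight_rayVec (j : Fin 3) (i : ℕ) : latWeight q (rayVec q j i) j = (rayCoord q i).1 :=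
  (exists_latWeight q j (rayCoord q i).1 (rayCoord q i).2).choose_spec.1

lemma latWeight_rayVec_succ (j : Fin 3) (i : ℕ) :
    latWeight q (rayVec q j i) (j + 1) = (rayCoord q i).2 :=
  (exists_latWeight q j (rayCoord q i).1 (rayCoord q i).2).choose_spec.2

lemma rayVec_ne_zero (q : ℕ) (j : Fin 3) (i : ℕ) : rayVec q j i ≠ 0 := by
  intro h
  have h1 := latWeight_rayVec_succ (q := q) j i
  rw [h, latWeight_zero, rayCoord] at h1
  split_ifs at h1 <;> simp at h1

/-- The compatible rays. -/
def ray (q : ℕ) (j : Fin 3) (i : ℕ) : Module.Ray ℝ (H0 3) :=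
  rayOfNeZero ℝ (rayVec q j i) (rayVec_ne_zero q j i)

lemma rayOfNeZero_eq_ray_iff {w : H0 3} (hw : w ≠ 0) {j : Fin 3} {i : ℕ} :
    rayOfNeZero ℝ w hw = ray q j i ↔ ∃ c : ℝ, 0 < c ∧
      latWeight q w j = c * (rayCoord q i).1 ∧ latWeight q w (j + 1) = c * (rayCoord q i).2 := by
  rw [ray, ray_eq_iff, ← exists_pos_right_iff_sameRay hw (rayVec_ne_zero q j i)]
  refine exists_congr fun c => and_congr_right fun _ => ?_
  rw [← latWeight_rayVec j i, ← latWeight_rayVec_succ j i]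
  constructor
  · intro h
    rw [h]
    exact ⟨latWeight_smul _ _ _, latWeight_smul _ _ _⟩
  · rintro ⟨h1, h2⟩
    exact eq_smul_of_latWeight j h1 h2

lemma rayCoord_of_le {i : ℕ} (hi : i ≤ q) : rayCoord q i = ((i : ℝ), 1) := if_pos hi

lemma rayCoord_last : rayCoord q (q + 1) = (0, -1) := if_neg (by omega)

lemma fin_three_cases (j l : Fin 3) : l = j ∨ l = j + 1 ∨ l = j + 2 := by revert j l; decide

lemma fin_three_add_two_add_one (j : Fin 3) : j + 2 + 1 = j := by revert j; decide
lemma fin_three_add_one_add_one (j : Fin 3) : j + 1 + 1 = j + 2 := by revert j; decide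

/-- The signs of w on v_j, v_{j+1}, v_{j+2} are (+, +, -) for 0 < i ≤ q, (0, +, -) for i = 0 and (0,
-, +) for i = q + 1. No two of these patterns, or of their rotations, coincide; in the first case
the ratio x / y gives i. -/
lemma ray_injective {j j' : Fin 3} {i i' : ℕ} (hi : i ≤ q + 1) (hi' : i' ≤ q + 1)
    (h : ray q j i = ray q j' i') : j = j' ∧ i = i' := by
  rw [ray, rayOfNeZero_eq_ray_iff] at h
  obtain ⟨c, hc, h1, h2⟩ := h
  have e0 := latWeight_rayVec (q := q) j i
  have e1 := latWeight_rayVec_succ (q := q) j i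
  have e2 := latWeight_add_two (q := q) (rayVec q j i) j
  rw [e0, e1] at e2
  have hi0 : (0 : ℝ) ≤ i := by positivity
  have hi0' : (0 : ℝ) ≤ i' := by positivity
  have hci : 0 ≤ c * i' := by positivity
  have hcase : i ≤ q ∨ i = q + 1 := by omega
  have hcase' : i' ≤ q ∨ i' = q + 1 := by omega
  obtain rfl | rfl | rfl := fin_three_cases j j'
  · refine ⟨rfl, ?_⟩
    rw [e0] at h1
    rw [e1] at h2
    rcases hcase with hi | rfl <;> rcases hcase' with hi' | rfl <;>
      simp only [rayCoord_of_le, rayCoord_last, hi, hi'] at h1 h2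
    · have : c = 1 := by linarith
      rw [this, one_mul] at h1
      exact_mod_cast h1
    · linarith
    · linarith
    · rfl
  · exfalso
    rw [e1] at h1
    rw [fin_three_add_one_add_one, e2] at h2
    rcases hcase with hi | rfl <;> rcases hcase' with hi' | rfl <;>
      simp only [rayCoord_of_le, rayCoord_last, hi, hi'] at h1 h2 <;> linarith
  · exfalso
    rw [e2] at h1
    rw [fin_three_add_two_add_one, e0] at h2
    rcases hcase with hi | rfl <;> rcases hcase' with hi' | rfl <;>
      simp only [rayCoord_of_le, rayCoord_last, hi, hi'] at h1 h2 <;> linarith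

/-- Minimality of the norm on the line orthogonal to w is automatic for a Hilbert basis element. -/
lemma compatible_iff {j : Fin 3} {w : H0 3} (hw : w ≠ 0)
    {a : Fin 3 → ℤ} :
    Compatible (lat q) j w a ↔ a ∈ hilbertBasis (orthant (lat q) (oneNeg j)) ∧ weight w a = 0 ∧
      ∀ b ∈ orthant (lat q) (oneNeg j), l1 b ≤ l1 a → 0 ≤ weight w b :=
  ⟨fun h => ⟨h.mem_hilbertBasis, h.orthogonal, h.weight_nonneg⟩, fun h =>
    ⟨h.2.1, fun _ hb hb0 hwb => l1_le_of_mem_hilbertBasis hw h.1 h.2.1 hb hb0 hwb, h.1, h.2.2⟩⟩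

lemma l1_latVec {j : Fin 3} {α β : ℤ}
    (h : latVec q j α β ∈ orthant (lat q) (oneNeg j)) :
    l1 (latVec q j α β) = 2 * ((q + 1) * α - q * β) := by
  rw [l1_eq_of_mem_orthant h, latVec_self]
  ring

/-- Orthogonality reads x = i y. Then v_j, no longer than (1, -i), has weight i y, so i > 0 forces y
≥ 0, and y = 0 would give w = 0. Conversely (α, β) has weight (iα + β) y, controlled by
`mul_add_nonneg_of_le`. -/
lemma compatible_latVec_one_iff (hq0 : 0 < q) (hq : ¬ (3 : ℤ) ∣ (q : ℤ) - 1) {j : Fin 3}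
    {w : H0 3} (hw : w ≠ 0) {i : ℕ} (hi : i ≤ q) :
    Compatible (lat q) j w (latVec q j 1 (-i)) ↔
      latWeight q w j = i * latWeight q w (j + 1) ∧ (i = 0 ∨ 0 < latWeight q w (j + 1)) := by
  have hmem := latVec_one_mem_orthant hq j hi
  have hmem0 := latVec_one_mem_orthant hq j (Nat.zero_le q)
  rw [compatible_iff hw]
  have hHB : latVec q j 1 (-i) ∈ hilbertBasis (orthant (lat q) (oneNeg j)) :=
    (mem_hilbertBasis_iff hq).2 (Or.inl ⟨i, hi, rfl⟩)
  simp only [hHB, true_and, weight_latVec]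
  push_cast
  constructor
  · rintro ⟨h1, h2⟩
    refine ⟨by linarith, ?_⟩
    rcases Nat.eq_zero_or_pos i with h0 | h0
    · exact Or.inl h0
    right
    have h3 := h2 _ hmem0 (by
      rw [l1_latVec hmem, l1_latVec hmem0]
      have : (0 : ℤ) ≤ q * i := by positivity
      push_cast
      linarith)
    rw [weight_latVec] at h3
    push_cast at h3
    have h4 : 0 ≤ (i : ℝ) * latWeight q w (j + 1) := by linarith
    have h5 : 0 ≤ latWeight q w (j + 1) := nonneg_of_mul_nonneg_right h4 (by exact_mod_cast h0)
    refine lt_of_le_of_ne h5 fun h => hw ?_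
    refine eq_zero_of_latWeight (q := q) j ?_ h.symm
    rw [← h] at h1
    linarith
  · rintro ⟨h1, h2⟩
    refine ⟨by linarith, ?_⟩
    intro b hb hle
    obtain ⟨α, β, rfl⟩ := (mem_lat_iff hq j).1 hb.1
    rw [l1_latVec hmem, l1_latVec hb] at hle
    rw [latVec_mem_orthant_iff hq] at hb
    rw [weight_latVec, h1]
    rcases coeff_pos hb.1 hb.2 with hα | ⟨rfl, rfl⟩
    swap
    · simp
    have hkey := mul_add_nonneg_of_le hq0 i hα (by linarith)
    rcases Nat.eq_zero_or_pos i with rfl | h0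
    · have hβ := eq_zero_of_short hq0 hα hb.1 (by push_cast at hle; linarith)
      rw [hβ]
      simp
    · have h3 := h2.resolve_left (by omega)
      have : (0 : ℝ) ≤ i * α + β := by exact_mod_cast hkey
      have := mul_nonneg this h3.le
      linarith

lemma compatible_long_iff (hq : ¬ (3 : ℤ) ∣ (q : ℤ) - 1) {j : Fin 3} {w : H0 3} (hw : w ≠ 0) :
    Compatible (lat q) j w (latVec q j (q + 1) 1) ↔
      latWeight q w (j + 1) = -(q + 1) * latWeight q w j ∧ 0 < latWeight q w j := by
  have hmem := latVec_long_mem_orthant hq j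
  have hmem0 := latVec_one_mem_orthant hq j (Nat.zero_le q)
  rw [compatible_iff hw]
  have hHB : latVec q j (q + 1) 1 ∈ hilbertBasis (orthant (lat q) (oneNeg j)) :=
    (mem_hilbertBasis_iff hq).2 (Or.inr rfl)
  simp only [hHB, true_and, weight_latVec]
  push_cast
  constructor
  · rintro ⟨h1, h2⟩
    refine ⟨by linarith, ?_⟩
    have h3 := h2 _ hmem0 (by
      rw [l1_latVec hmem, l1_latVec hmem0]
      push_cast
      nlinarith)
    rw [weight_latVec] at h3
    push_cast at h3
    refine lt_of_le_of_ne (by linarith) fun h => hw ?_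
    refine eq_zero_of_latWeight (q := q) j h.symm ?_
    rw [← h] at h1
    linarith
  · rintro ⟨h1, h2⟩
    refine ⟨by linarith, ?_⟩
    intro b hb _
    obtain ⟨α, β, rfl⟩ := (mem_lat_iff hq j).1 hb.1
    rw [latVec_mem_orthant_iff hq] at hb
    rw [weight_latVec, h1]
    have : (0 : ℝ) ≤ α - (q + 1) * β := by exact_mod_cast hb.1
    have := mul_nonneg this h2.le
    linarith

lemma compatibleRays_latVec_one (hq0 : 0 < q) (hq : ¬ (3 : ℤ) ∣ (q : ℤ) - 1) (j : Fin 3) {i : ℕ}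
    (hi : i ≤ q) (hi0 : 0 < i) :
    compatibleRays (lat q) j (latVec q j 1 (-i)) = {ray q j i} := by
  have key : ∀ (w : H0 3) (hw : w ≠ 0), Compatible (lat q) j w (latVec q j 1 (-i)) ↔
      rayOfNeZero ℝ w hw = ray q j i := by
    intro w hw
    rw [compatible_latVec_one_iff hq0 hq hw hi, rayOfNeZero_eq_ray_iff, rayCoord_of_le hi]
    constructor
    · rintro ⟨h1, h2⟩
      exact ⟨_, h2.resolve_left (by omega), by rw [h1]; ring, by ring⟩
    · rintro ⟨c, hc, h1, h2⟩
      simp only [mul_one] at h1 h2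
      rw [h1, h2]
      exact ⟨by ring, Or.inr hc⟩
  ext ρ
  simp only [compatibleRays, Set.mem_ofPred_eq, Set.mem_singleton_iff]
  constructor
  · rintro ⟨w, hw, rfl, h⟩
    exact (key w hw).1 h
  · rintro rfl
    exact ⟨_, rayVec_ne_zero q j i, rfl, (key _ _).2 rfl⟩

/-- The vector (q+1, 1) of S_j is the opposite of (1, -q) of S_{j+2}, so no new ray arises. -/
lemma compatibleRays_long (hq : ¬ (3 : ℤ) ∣ (q : ℤ) - 1) (j : Fin 3) :
    compatibleRays (lat q) j (latVec q j (q + 1) 1) = {ray q (j + 2) q} := by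
  have key : ∀ (w : H0 3) (hw : w ≠ 0), Compatible (lat q) j w (latVec q j (q + 1) 1) ↔
      rayOfNeZero ℝ w hw = ray q (j + 2) q := by
    intro w hw
    rw [compatible_long_iff hq hw, rayOfNeZero_eq_ray_iff, rayCoord_of_le le_rfl,
      fin_three_add_two_add_one, latWeight_add_two]
    constructor
    · rintro ⟨h1, h2⟩
      exact ⟨_, h2, by rw [h1]; ring, by ring⟩
    · rintro ⟨c, hc, h1, h2⟩
      simp only [mul_one] at h1 h2
      rw [h2]
      exact ⟨by linear_combination -h1 - h2, hc⟩
  ext ρ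
  simp only [compatibleRays, Set.mem_ofPred_eq, Set.mem_singleton_iff]
  constructor
  · rintro ⟨w, hw, rfl, h⟩
    exact (key w hw).1 h
  · rintro rfl
    exact ⟨_, rayVec_ne_zero _ _ _, rfl, (key _ _).2 rfl⟩

lemma compatibleRays_short (hq0 : 0 < q) (hq : ¬ (3 : ℤ) ∣ (q : ℤ) - 1) (j : Fin 3) :
    compatibleRays (lat q) j (latVec q j 1 0) = {ray q j 0, ray q j (q + 1)} := by
  have key : ∀ (w : H0 3) (hw : w ≠ 0), Compatible (lat q) j w (latVec q j 1 0) ↔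
      rayOfNeZero ℝ w hw = ray q j 0 ∨ rayOfNeZero ℝ w hw = ray q j (q + 1) := by
    intro w hw
    have := compatible_latVec_one_iff hq0 hq (j := j) hw (Nat.zero_le q)
    simp only [Nat.cast_zero, neg_zero, zero_mul, true_or, and_true] at this
    rw [this, rayOfNeZero_eq_ray_iff, rayOfNeZero_eq_ray_iff, rayCoord_of_le (Nat.zero_le q),
      rayCoord_last]
    simp only [Nat.cast_zero, mul_zero, mul_one, mul_neg]
    constructor
    · intro h
      rcases lt_trichotomy (latWeight q w (j + 1)) 0 with h' | h' | h'
      · exact Or.inr ⟨_, neg_pos.2 h', h, by ring⟩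
      · exact absurd (eq_zero_of_latWeight j h h') hw
      · exact Or.inl ⟨_, h', h, rfl⟩
    · rintro (⟨c, -, h, -⟩ | ⟨c, -, h, -⟩) <;> exact h
  ext ρ
  simp only [compatibleRays, Set.mem_ofPred_eq, Set.mem_insert_iff, Set.mem_singleton_iff]
  constructor
  · rintro ⟨w, hw, rfl, h⟩
    exact (key w hw).1 h
  · rintro (rfl | rfl)
    · exact ⟨_, rayVec_ne_zero _ _ _, rfl, (key _ _).2 (Or.inl rfl)⟩
    · exact ⟨_, rayVec_ne_zero _ _ _, rfl, (key _ _).2 (Or.inr rfl)⟩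

lemma neg_ray_zero (j : Fin 3) : -ray q j 0 = ray q j (q + 1) := by
  rw [ray, neg_rayOfNeZero, rayOfNeZero_eq_ray_iff]
  refine ⟨1, one_pos, ?_, ?_⟩
  · rw [latWeight_neg, latWeight_rayVec, rayCoord_of_le (Nat.zero_le q), rayCoord_last]
    simp
  · rw [latWeight_neg, latWeight_rayVec_succ, rayCoord_of_le (Nat.zero_le q), rayCoord_last]
    simp

lemma setOf_compatible_eq (hq0 : 0 < q) (hq : ¬ (3 : ℤ) ∣ (q : ℤ) - 1) :
    {ρ | ∃ j a, ρ ∈ compatibleRays (lat q) j a} =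
      Set.range fun x : Fin 3 × Fin (q + 2) => ray q x.1 x.2 := by
  ext ρ
  constructor
  · rintro ⟨j, a, h⟩
    have hHB : a ∈ hilbertBasis (orthant (lat q) (oneNeg j)) := by
      obtain ⟨w, hw, -, h⟩ := h
      exact h.mem_hilbertBasis
    rcases (mem_hilbertBasis_iff hq).1 hHB with ⟨i, hi, rfl⟩ | rfl
    · rcases Nat.eq_zero_or_pos i with rfl | h0
      · rw [Nat.cast_zero, neg_zero, compatibleRays_short hq0 hq] at h
        rcases h with rfl | rfl
        · exact ⟨(j, ⟨0, by omega⟩), rfl⟩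
        · exact ⟨(j, ⟨q + 1, by omega⟩), rfl⟩
      · rw [compatibleRays_latVec_one hq0 hq j hi h0] at h
        exact ⟨(j, ⟨i, by omega⟩), h.symm⟩
    · rw [compatibleRays_long hq] at h
      exact ⟨(j + 2, ⟨q, by omega⟩), h.symm⟩
  · rintro ⟨⟨j, i, hi⟩, rfl⟩
    refine ⟨j, ?_⟩
    obtain rfl | ⟨h0, h1⟩ | rfl : i = 0 ∨ (0 < i ∧ i ≤ q) ∨ i = q + 1 := by omega
    · exact ⟨latVec q j 1 0, by rw [compatibleRays_short hq0 hq]; exact Or.inl rfl⟩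
    · exact ⟨latVec q j 1 (-i), by rw [compatibleRays_latVec_one hq0 hq j h1 h0]; rfl⟩
    · exact ⟨latVec q j 1 0, by rw [compatibleRays_short hq0 hq]; exact Or.inr rfl⟩

lemma ncard_setOf_compatible (hq0 : 0 < q) (hq : ¬ (3 : ℤ) ∣ (q : ℤ) - 1) :
    {ρ | ∃ j a, ρ ∈ compatibleRays (lat q) j a}.ncard = 3 * (q + 2) := by
  rw [setOf_compatible_eq hq0 hq, ← Set.image_univ, Set.ncard_image_of_injective, Set.ncard_univ]
  · simp
  · rintro ⟨j, i, hi⟩ ⟨j', i', hi'⟩ h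
    obtain ⟨rfl, h⟩ := ray_injective (by omega) (by omega) h
    simp only at h
    subst h
    rfl

end

/-! ### Graded orders from weights, and closures of cones. -/

section

variable {r : ℕ}

/-- A vector of `ℕ^r` as an integer vector. -/
def toInt (a : Fin r →₀ ℕ) : Fin r → ℤ := fun i => a i

lemma toInt_add (a b : Fin r →₀ ℕ) : toInt (a + b) = toInt a + toInt b := by
  funext i; simp [toInt]

lemma toInt_injective : Function.Injective (toInt (r := r)) := by
  intro a b h
  ext i
  have := congrFun h i
  simpa [toInt] using this

lemma natWeight_eq (w : H0 r) (a : Fin r →₀ ℕ) : natWeight w a = weight w (toInt a) := by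
  simp [natWeight, weight, toInt]

lemma natWeight_add (w : H0 r) (a b : Fin r →₀ ℕ) :
    natWeight w (a + b) = natWeight w a + natWeight w b := by
  rw [natWeight_eq, toInt_add, weight_add, natWeight_eq, natWeight_eq]

lemma weight_toInt_sub (w : H0 r) (a b : Fin r →₀ ℕ) :
    weight w (toInt a - toInt b) = natWeight w a - natWeight w b := by
  rw [sub_eq_add_neg, weight_add, weight_neg, natWeight_eq, natWeight_eq, sub_eq_add_neg]

lemma sum_toInt (a : Fin r →₀ ℕ) : ∑ i, toInt a i = a.degree := by
  rw [Finsupp.degree_eq_sum]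
  simp [toInt]

lemma sum_toInt_sub (a b : Fin r →₀ ℕ) :
    ∑ i, (toInt a - toInt b) i = (a.degree : ℤ) - b.degree := by
  simp [Finset.sum_sub_distrib, sum_toInt]

lemma exists_toInt_of_nonneg {a : Fin r → ℤ} (h : ∀ i, 0 ≤ a i) : ∃ x, toInt x = a :=
  ⟨Finsupp.equivFunOnFinite.symm fun i => (a i).toNat, by
    funext i
    simp [toInt, h i]⟩

lemma exists_toInt_sub (a : Fin r → ℤ) : ∃ x y : Fin r →₀ ℕ, toInt x - toInt y = a := by
  obtain ⟨x, hx⟩ := exists_toInt_of_nonneg (a := a⁺) (fun i => posPart_nonneg a i)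
  obtain ⟨y, hy⟩ := exists_toInt_of_nonneg (a := a⁻) (fun i => negPart_nonneg a i)
  exact ⟨x, y, by rw [hx, hy, posPart_sub_negPart]⟩

/-- Total degree, then the weight `w`, then the weight `u`. -/
def weightKey (w u : H0 r) (a : Fin r →₀ ℕ) : ℕ ×ₗ ℝ ×ₗ ℝ :=
  toLex (a.degree, toLex (natWeight w a, natWeight u a))

lemma weightKey_add (w u : H0 r) (a b : Fin r →₀ ℕ) :
    weightKey w u (a + b) = weightKey w u a + weightKey w u b := by
  simp only [weightKey, map_add, natWeight_add]
  rfl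

/-- No non-zero integer vector with coordinate sum zero is orthogonal to both `w` and `u`. -/
def Separates (w u : H0 r) : Prop :=
  ∀ a : Fin r → ℤ, ∑ i, a i = 0 → weight w a = 0 → weight u a = 0 → a = 0

lemma weightKey_injective {w u : H0 r} (h : Separates w u) :
    Function.Injective (weightKey w u) := by
  intro a b hab
  simp only [weightKey, EmbeddingLike.apply_eq_iff_eq, Prod.mk.injEq] at hab
  have := h (toInt a - toInt b) (by rw [sum_toInt_sub, hab.1, sub_self])
    (by rw [weight_toInt_sub, hab.2.1, sub_self]) (by rw [weight_toInt_sub, hab.2.2, sub_self])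
  exact toInt_injective (sub_eq_zero.1 this)

lemma degree_le_of_weightKey_le {w u : H0 r} {a b : Fin r →₀ ℕ}
    (h : weightKey w u a ≤ weightKey w u b) : a.degree ≤ b.degree := by
  rw [weightKey, weightKey, Prod.Lex.toLex_le_toLex] at h
  rcases h with h | h
  · exact h.le
  · exact h.1.le

lemma weightKey_lt_of_degree_lt {w u : H0 r} {a b : Fin r →₀ ℕ}
    (h : a.degree < b.degree) : weightKey w u a < weightKey w u b :=
  lt_of_not_ge fun h' => absurd (degree_le_of_weightKey_le h') (by omega)

lemma weightKey_add_le_add_right {w u : H0 r} {a b : Fin r →₀ ℕ}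
    (h : weightKey w u a ≤ weightKey w u b) (c : Fin r →₀ ℕ) :
    weightKey w u (a + c) ≤ weightKey w u (b + c) := by
  rw [weightKey_add, weightKey_add]
  gcongr

lemma weightKey_add_le_add_left {w u : H0 r} {a b : Fin r →₀ ℕ}
    (h : weightKey w u a ≤ weightKey w u b) (c : Fin r →₀ ℕ) :
    weightKey w u (c + a) ≤ weightKey w u (c + b) := by
  rw [weightKey_add, weightKey_add]
  gcongr

/-- The type carrying the order given by `weightKey`. -/
def WeightSyn (_w _u : H0 r) : Type := Fin r →₀ ℕ

instance (w u : H0 r) : AddCommMonoid (WeightSyn w u) :=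
  inferInstanceAs (AddCommMonoid (Fin r →₀ ℕ))

/-- The graded monomial order refined by the weight `w` and then by the weight `u`. -/
def weightOrder (w u : H0 r) (h : Separates w u) : MonomialOrder.{0, 0} (Fin r) where
  syn := WeightSyn w u
  linearOrderSyn := LinearOrder.lift' (weightKey w u) (weightKey_injective h)
  isOrderedAddMonoid_syn := by
    let _ : LinearOrder (WeightSyn w u) :=
      LinearOrder.lift' (weightKey w u) (weightKey_injective h)
    refine IsOrderedAddMonoid.mk (α := WeightSyn w u) ?_ ?_
    all_goals
      intro a b hab c
      first
        | exact weightKey_add_le_add_right (a := a) (b := b) hab c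
        | exact weightKey_add_le_add_left (a := a) (b := b) hab c
  toSyn := { toEquiv := Equiv.refl (Fin r →₀ ℕ), map_add' := fun _ _ => rfl }
  toSyn_monotone := by
    intro a b hab
    change weightKey w u a ≤ weightKey w u b
    rcases (Finsupp.degree_mono hab).lt_or_eq with h' | h'
    · exact (weightKey_lt_of_degree_lt h').le
    · obtain ⟨c, rfl⟩ := le_iff_exists_add.1 hab
      have : c = 0 := by
        rw [← Finsupp.degree_eq_zero_iff]
        rw [map_add] at h'
        omega
      rw [this, add_zero]
  wellFoundedLT_syn := by
    constructor
    change WellFounded fun a b : Fin r →₀ ℕ => weightKey w u a < weightKey w u b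
    rw [WellFounded.wellFounded_iff_has_min]
    intro s hs
    obtain ⟨a, ha⟩ := hs
    -- Real weights are not well ordered, but a bound on the degree leaves finitely many vectors.
    obtain ⟨b, hb, hmin⟩ := Set.exists_min_image (s ∩ {b | b.degree ≤ a.degree}) (weightKey w u)
      ((Finsupp.finite_of_degree_le _).inter_of_right _) ⟨a, ha, le_refl a.degree⟩
    refine ⟨b, hb.1, fun x hx => not_lt.2 ?_⟩
    by_cases hxa : x.degree ≤ a.degree
    · exact hmin x ⟨hx, hxa⟩
    · exact (weightKey_lt_of_degree_lt (lt_of_le_of_lt hb.2 (not_le.1 hxa))).le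

lemma weightOrder_le_iff {w u : H0 r} {h : Separates w u} {a b : Fin r →₀ ℕ} :
    a ≼[weightOrder w u h] b ↔ weightKey w u a ≤ weightKey w u b := Iff.rfl

lemma isGraded_weightOrder {w u : H0 r} (h : Separates w u) : IsGraded (weightOrder w u h) :=
  fun _ _ hab => weightKey_lt_of_degree_lt hab

lemma weightOrder_le_iff_of_degree_eq {w u : H0 r} {h : Separates w u} {a b : Fin r →₀ ℕ}
    (hab : a.degree = b.degree) : a ≼[weightOrder w u h] b ↔
      natWeight w a < natWeight w b ∨ natWeight w a = natWeight w b ∧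
        natWeight u a ≤ natWeight u b := by
  rw [weightOrder_le_iff, weightKey, weightKey, Prod.Lex.toLex_le_toLex, Prod.Lex.toLex_le_toLex]
  simp [hab]

/-- `D` picks for every vertex the smallest routing. -/
structure IsMinFor (N : ℕ) (s : Fin r → ℕ) (m : MonomialOrder.{0, 0} (Fin r))
    (D : ZMod N → (Fin r →₀ ℕ)) : Prop where
  endpoint_eq : ∀ c, endpoint N s (D c) = c
  le : ∀ c b, endpoint N s b = c → D c ≼[m] b

lemma endpoint_add (N : ℕ) (s : Fin r → ℕ) (a b : Fin r →₀ ℕ) :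
    endpoint N s (a + b) = endpoint N s a + endpoint N s b := by
  simp [endpoint, add_mul, Finset.sum_add_distrib]

lemma degree_le_of_le {m : MonomialOrder.{0, 0} (Fin r)} (hm : IsGraded m) {a b : Fin r →₀ ℕ}
    (h : a ≼[m] b) : a.degree ≤ b.degree :=
  le_of_not_gt fun h' => absurd (hm _ _ h') (not_lt.2 h)

lemma IsMinFor.isMDD {N : ℕ} {s : Fin r → ℕ} {m : MonomialOrder.{0, 0} (Fin r)}
    (hm : IsGraded m) {D : ZMod N → (Fin r →₀ ℕ)} (hD : IsMinFor N s m D) : IsMDD N s D where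
  endpoint_eq := hD.endpoint_eq
  degree_le c b hb := degree_le_of_le hm (hD.le c b hb)
  mem_range_of_le c b hb := by
    refine ⟨endpoint N s b, ?_⟩
    obtain ⟨d, hd⟩ := le_iff_exists_add.1 hb
    set b' := D (endpoint N s b)
    have h1 : b' ≼[m] b := hD.le _ _ rfl
    -- Replacing b by b' in D c = b + d gives another routing to c; cancelling d then yields b ≼ b'.
    have h2 : D c ≼[m] (b' + d) := by
      apply hD.le
      rw [endpoint_add, hD.endpoint_eq, ← endpoint_add, ← hd, hD.endpoint_eq]
    rw [hd, map_add, map_add, add_le_add_iff_right] at h2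
    exact m.toSyn.injective (le_antisymm h1 h2)

lemma isCoherentMDD_iff {N : ℕ} {s : Fin r → ℕ} {D : ZMod N → (Fin r →₀ ℕ)} :
    IsCoherentMDD N s D ↔ ∃ m : MonomialOrder.{0, 0} (Fin r), IsGraded m ∧ IsMinFor N s m D :=
  ⟨fun ⟨h, m, hm, hD⟩ => ⟨m, hm, h.endpoint_eq, hD⟩,
    fun ⟨m, hm, hD⟩ => ⟨hD.isMDD hm, m, hm, hD.le⟩⟩

lemma exists_isMinFor {N : ℕ} {s : Fin r → ℕ} (hs : Function.Surjective (endpoint N s))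
    (m : MonomialOrder.{0, 0} (Fin r)) : ∃ D, IsMinFor N s m D := by
  have h : ∀ c, ∃ a, endpoint N s a = c ∧ ∀ b, endpoint N s b = c → a ≼[m] b := by
    intro c
    have hne : (m.toSyn '' {a | endpoint N s a = c}).Nonempty := Set.Nonempty.image _ (hs c)
    obtain ⟨x, ⟨a, ha, rfl⟩, hmin⟩ := WellFounded.has_min (wellFounded_lt (α := m.syn)) _ hne
    exact ⟨a, ha, fun b hb => not_lt.1 (hmin _ ⟨b, hb, rfl⟩)⟩
  choose D hD using h
  exact ⟨D, fun c => (hD c).1, fun c => (hD c).2⟩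

/-- A weight vector lies in the closure of the cone of each diagram given by a graded order that
refines it. -/
lemma IsMinFor.mem_closure {N : ℕ} [NeZero N] {s : Fin r → ℕ} {w u : H0 r} {h : Separates w u}
    {D : ZMod N → (Fin r →₀ ℕ)} (hD : IsMinFor N s (weightOrder w u h) D) :
    w ∈ closure (mddCone N s D) := by
  -- Finitely many vertices, each with finitely many competitors of the same length: one small ε > 0
  -- keeps every strict w-inequality and lets u decide every w-tie.
  have hev : ∀ᶠ ε : ℝ in nhdsWithin 0 (Set.Ioi 0), w + ε • u ∈ mddCone N s D := by
    have h1 : ∀ᶠ ε : ℝ in nhdsWithin 0 (Set.Ioi 0), ∀ c, ∀ b ∈ {b | b.degree = (D c).degree},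
        endpoint N s b = c → b ≠ D c →
          natWeight (w + ε • u) (D c) < natWeight (w + ε • u) b := by
      rw [Filter.eventually_all]
      intro c
      rw [Filter.eventually_all_finite (Finsupp.finite_of_degree_eq _)]
      intro b hb
      rw [Filter.eventually_imp_distrib_left]
      intro hbc
      rw [Filter.eventually_imp_distrib_left]
      intro hne
      have hle := (weightOrder_le_iff_of_degree_eq (h := h) hb.symm).1 (hD.le c b hbc)
      have hform : ∀ (ε : ℝ) (a : Fin r →₀ ℕ),
          natWeight (w + ε • u) a = natWeight w a + ε * natWeight u a := by
        intro ε a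
        simp only [natWeight_eq, weight_add_left, weight_smul]
      simp only [hform]
      rcases hle with hlt | ⟨heq, hle⟩
      · have hcont : ∀ a : Fin r →₀ ℕ, Filter.Tendsto
            (fun ε : ℝ => natWeight w a + ε * natWeight u a) (nhdsWithin 0 (Set.Ioi 0))
            (nhds (natWeight w a)) := by
          intro a
          have : Continuous fun ε : ℝ => natWeight w a + ε * natWeight u a := by fun_prop
          have := (this.tendsto 0).mono_left (nhdsWithin_le_nhds (s := Set.Ioi 0))
          simpa using this
        exact (hcont _).eventually_lt (hcont _) hlt
      · have hlt : natWeight u (D c) < natWeight u b := by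
          refine lt_of_le_of_ne hle fun heq' => hne ?_
          refine weightKey_injective h ?_
          rw [weightKey, weightKey, show b.degree = (D c).degree from hb, heq, heq']
        filter_upwards [self_mem_nhdsWithin] with ε hε
        rw [heq]
        have : ε * natWeight u (D c) < ε * natWeight u b := mul_lt_mul_of_pos_left hlt hε
        linarith
    filter_upwards [h1] with ε hε
    exact ⟨hD.isMDD (isGraded_weightOrder h), fun c b hb hdeg hne => hε c b hdeg hb hne⟩
  have hlim : Filter.Tendsto (fun ε : ℝ => w + ε • u) (nhdsWithin 0 (Set.Ioi 0)) (nhds w) := by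
    have : Continuous fun ε : ℝ => w + ε • u := by fun_prop
    have := (this.tendsto 0).mono_left (nhdsWithin_le_nhds (s := Set.Ioi 0))
    simpa using this
  exact mem_closure_of_tendsto hlim hev

lemma natWeight_le_of_mem_closure {N : ℕ} {s : Fin r → ℕ} {w : H0 r}
    {D : ZMod N → (Fin r →₀ ℕ)} (hw : w ∈ closure (mddCone N s D)) {b : Fin r →₀ ℕ} {c : ZMod N}
    (hb : endpoint N s b = c) (hdeg : b.degree = (D c).degree) :
    natWeight w (D c) ≤ natWeight w b := by
  have hcont : ∀ a : Fin r →₀ ℕ, Continuous fun w : H0 r => natWeight w a := by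
    intro a
    unfold natWeight
    refine continuous_finsetSum _ fun i _ => ?_
    exact ((continuous_apply i).comp continuous_subtype_val).mul continuous_const
  have hcl : IsClosed {w : H0 r | natWeight w (D c) ≤ natWeight w b} :=
    isClosed_le (hcont _) (hcont _)
  refine closure_minimal ?_ hcl hw
  intro w' hw'
  by_cases hne : b = D c
  · simp [hne]
  · exact (hw'.2 c b hb hdeg hne).le

lemma isMDD_of_mem_closure {N : ℕ} {s : Fin r → ℕ} {w : H0 r}
    {D : ZMod N → (Fin r →₀ ℕ)} (hw : w ∈ closure (mddCone N s D)) : IsMDD N s D := by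
  obtain ⟨w', hw'⟩ := closure_nonempty_iff.1 ⟨w, hw⟩
  exact hw'.1

/-- Any two MDD's give routings of the same length. -/
lemma IsMDD.degree_eq {N : ℕ} {s : Fin r → ℕ} {D D' : ZMod N → (Fin r →₀ ℕ)}
    (hD : IsMDD N s D) (hD' : IsMDD N s D') (c : ZMod N) : (D c).degree = (D' c).degree :=
  le_antisymm (hD.degree_le c _ (hD'.endpoint_eq c)) (hD'.degree_le c _ (hD.endpoint_eq c))

lemma finite_setOf_isMDD (N : ℕ) [NeZero N] (s : Fin r → ℕ) : {D | IsMDD N s D}.Finite := by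
  by_cases h : ∃ D, IsMDD N s D
  · obtain ⟨D, hD⟩ := h
    refine (Set.Finite.pi fun c => Finsupp.finite_of_degree_eq (D c).degree).subset ?_
    intro D' hD' c _
    exact hD'.degree_eq hD c
  · push Not at h
    simp [h]

/-- The rotation of a weight vector by a quarter turn in `H₀`, up to scaling. -/
def quarterTurn (w : H0 3) : H0 3 :=
  ⟨![w.1 2 - w.1 1, w.1 0 - w.1 2, w.1 1 - w.1 0], by
    show ∑ i, _ = _
    simp [Fin.sum_univ_three]⟩

/-- `quarterTurn w` is (1, 1, 1) × w, so it forms an orthogonal basis with w and (1, 1, 1). The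
linear combinations in the proof expand a in this basis. -/
lemma separates_quarterTurn {w : H0 3} (hw : w ≠ 0) : Separates w (quarterTurn w) := by
  intro a ha hwa hua
  rw [Fin.sum_univ_three] at ha
  have ha' : (a 0 + a 1 + a 2 : ℝ) = 0 := by exact_mod_cast ha
  have hw0 : w.1 0 + w.1 1 + w.1 2 = 0 := sum_weight_eq_zero w 0
  simp [weight, quarterTurn, Fin.sum_univ_three] at hwa hua
  have hsq : 0 < w.1 0 ^ 2 + w.1 1 ^ 2 + w.1 2 ^ 2 := by
    by_contra h
    apply hw
    apply Subtype.ext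
    funext i
    revert i
    rw [forall_fin_three (j := 0)]
    refine ⟨show w.1 0 = 0 by nlinarith, show w.1 1 = 0 by nlinarith, show w.1 2 = 0 by nlinarith⟩
  have e : w.1 2 = -w.1 0 - w.1 1 := by linarith
  have key : ∀ x : ℝ, 3 * (w.1 0 ^ 2 + w.1 1 ^ 2 + w.1 2 ^ 2) * x = 0 → x = 0 := fun x hx =>
    (mul_eq_zero.1 hx).resolve_left (by positivity)
  have h0 : (a 0 : ℝ) = 0 := by
    apply key
    rw [e] at hwa hua ⊢
    linear_combination (w.1 0 ^ 2 + w.1 1 ^ 2 + (-w.1 0 - w.1 1) ^ 2) * ha' + 3 * w.1 0 * hwa +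
      (-w.1 0 - 2 * w.1 1) * hua
  have h1 : (a 1 : ℝ) = 0 := by
    apply key
    rw [e] at hwa hua ⊢
    linear_combination (w.1 0 ^ 2 + w.1 1 ^ 2 + (-w.1 0 - w.1 1) ^ 2) * ha' + 3 * w.1 1 * hwa +
      (2 * w.1 0 + w.1 1) * hua
  have h2 : (a 2 : ℝ) = 0 := by linarith
  funext i
  revert i
  rw [forall_fin_three (j := 0)]
  exact ⟨by exact_mod_cast h0, by exact_mod_cast h1, by exact_mod_cast h2⟩

lemma Separates.neg {w u : H0 r} (h : Separates w u) : Separates w (-u) := by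
  intro a ha hwa hua
  rw [weight_neg_left, neg_eq_zero] at hua
  exact h a ha hwa hua

end

/-! ### Routings in the network, and boundary rays. -/

section

/-- The routings of equal length to the same vertex of the network `C_M(s₁,s₂,s₃)` differ by the
elements of `L`, and the lengths of all routings to a vertex are congruent modulo `k`. -/
structure HasRoutingLattice (M : ℕ) (s : Fin 3 → ℕ) (L : AddSubgroup (Fin 3 → ℤ)) (k : ℕ) :
    Prop where
  surjective : Function.Surjective (endpoint M s)
  dvd_sub : ∀ x y, endpoint M s x = endpoint M s y → (k : ℤ) ∣ (x.degree : ℤ) - y.degree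
  endpoint_eq_iff : ∀ x y : Fin 3 →₀ ℕ, x.degree = y.degree →
    (endpoint M s x = endpoint M s y ↔ toInt x - toInt y ∈ L)

lemma endpoint_eq_intCast {r : ℕ} (M : ℕ) (s : Fin r → ℕ) (x : Fin r →₀ ℕ) :
    endpoint M s x = ((∑ i, toInt x i * (s i : ℤ) : ℤ) : ZMod M) := by
  simp [endpoint, toInt]

lemma endpoint_eq_endpoint_iff {r : ℕ} {M : ℕ} {s : Fin r → ℕ} {x y : Fin r →₀ ℕ} :
    endpoint M s x = endpoint M s y ↔ (M : ℤ) ∣ ∑ i, (toInt x - toInt y) i * (s i : ℤ) := by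
  rw [← sub_eq_zero, endpoint_eq_intCast, endpoint_eq_intCast, ← Int.cast_sub,
    ZMod.intCast_zmod_eq_zero_iff_dvd, ← Finset.sum_sub_distrib]
  simp only [Pi.sub_apply, sub_mul]

/-- Σ a_i (t + k s_i) = t Σ a_i + k Σ a_i s_i. Modulo k only the first term survives and t is
invertible, so lengths agree modulo k; when Σ a_i = 0, k cancels and the congruence modulo N
remains. -/
lemma hasRoutingLattice {q k t : ℕ} (hq : ¬ (3 : ℤ) ∣ (q : ℤ) - 1) (hk : 0 < k)
    (htk : Nat.gcd t k = 1) :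
    HasRoutingLattice ((1 + q + q ^ 2) * k) ![t + k, t + q * k, t + q ^ 2 * k] (lat q) k := by
  have hsum : ∀ a : Fin 3 → ℤ,
      ∑ i, a i * ((![t + k, t + q * k, t + q ^ 2 * k] : Fin 3 → ℕ) i : ℤ) =
        t * ∑ i, a i + k * (∑ i, a i * ((![1, q, q ^ 2] : Fin 3 → ℕ) i : ℤ)) := by
    intro a
    simp [Fin.sum_univ_three]
    ring
  have hcop : IsCoprime (t : ℤ) k := Nat.isCoprime_iff_coprime.2 htk
  refine ⟨?_, ?_, ?_⟩
  · have : NeZero ((1 + q + q ^ 2) * k) := ⟨by positivity⟩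
    set M := (1 + q + q ^ 2) * k with hM
    obtain ⟨A, B, hAB⟩ := isCoprime_sub_one hq
    obtain ⟨C, E, hCE⟩ := hcop
    intro c
    -- This gives x₀ + x₁ = C and x₀ + q x₁ ≡ E modulo N, so the combination of generators is C t +
    -- E k = 1 modulo N k.
    let x₁ : ℤ := (E - C) * A
    let x₀ : ℤ := C - x₁
    refine ⟨Finsupp.equivFunOnFinite.symm ![(c * (x₀ : ZMod M)).val, (c * (x₁ : ZMod M)).val, 0], ?_⟩
    have hone : (x₀ : ZMod M) * ((t + k : ℕ) : ZMod M) + x₁ * ((t + q * k : ℕ) : ZMod M) = 1 := by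
      have h : (x₀ * (t + k) + x₁ * (t + q * k) : ℤ) = 1 - (E - C) * B * (M : ℤ) := by
        simp only [x₀, x₁, hM]
        push_cast
        linear_combination hCE + (E - C) * k * hAB
      have h' := congrArg (Int.cast : ℤ → ZMod M) h
      push_cast at h' ⊢
      rw [h']
      simp
    simp [endpoint, Fin.sum_univ_three]
    push_cast at hone
    linear_combination c * hone
  · intro x y hxy
    rw [endpoint_eq_endpoint_iff, hsum, sum_toInt_sub] at hxy
    have h1 : (k : ℤ) ∣ t * ((x.degree : ℤ) - y.degree) := by
      refine (Int.dvd_add_left (dvd_mul_right _ _)).1 (dvd_trans ?_ hxy)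
      push_cast
      exact dvd_mul_left _ _
    exact hcop.symm.dvd_of_dvd_mul_left h1
  · intro x y hdeg
    rw [endpoint_eq_endpoint_iff, hsum, sum_toInt_sub, hdeg, sub_self, mul_zero, zero_add,
      Nat.cast_mul, mul_comm, mul_dvd_mul_iff_left (by exact_mod_cast hk.ne')]
    exact ⟨fun h => ⟨h, by rw [sum_toInt_sub, hdeg, sub_self]⟩, fun h => h.1⟩

/-- A lattice vector or its opposite is in one of the octants with one negative sign. -/
lemma exists_mem_orthant {q : ℕ} {a : Fin 3 → ℤ} (ha : a ∈ lat q) :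
    ∃ j, a ∈ orthant (lat q) (oneNeg j) ∨ -a ∈ orthant (lat q) (oneNeg j) := by
  have hs : a 0 + a 1 + a 2 = 0 := sum_eq_zero_of_mem ha 0
  have hneg : -a ∈ lat q := neg_mem ha
  simp only [mem_orthant_iff, ha, hneg, true_and, Pi.neg_apply]
  rcases le_total (a 0) 0 with h0 | h0 <;> rcases le_total (a 1) 0 with h1 | h1 <;>
    rcases le_total (a 2) 0 with h2 | h2
  · exact ⟨0, Or.inl (by simp; omega)⟩
  · exact ⟨2, Or.inr (by simp; omega)⟩
  · exact ⟨1, Or.inr (by simp; omega)⟩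
  · exact ⟨0, Or.inl (by simp; omega)⟩
  · exact ⟨0, Or.inr (by simp; omega)⟩
  · exact ⟨1, Or.inl (by simp; omega)⟩
  · exact ⟨2, Or.inl (by simp; omega)⟩
  · exact ⟨0, Or.inr (by simp; omega)⟩

lemma neg_self_le_of_mem_hilbertBasis {q : ℕ} (hq : ¬ (3 : ℤ) ∣ (q : ℤ) - 1) {j : Fin 3}
    {a : Fin 3 → ℤ} (ha : a ∈ hilbertBasis (orthant (lat q) (oneNeg j))) : -a j ≤ (1 + q + q ^ 2 : ℕ) := by
  rcases (mem_hilbertBasis_iff hq).1 ha with ⟨i, hi, rfl⟩ | rfl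
  · rw [latVec_self]
    have : (i : ℤ) ≤ q := by exact_mod_cast hi
    have : (0 : ℤ) ≤ q * (q - i) := mul_nonneg (by positivity) (by linarith)
    push_cast
    linarith
  · rw [latVec_self]
    push_cast
    linarith

namespace HasRoutingLattice

variable {M k : ℕ} {s : Fin 3 → ℕ} {q : ℕ}

lemma degree_le (hL : HasRoutingLattice M s (lat q) k) {x y : Fin 3 →₀ ℕ}
    (h : endpoint M s x = endpoint M s y) (hx : x.degree < k) : x.degree ≤ y.degree := by
  by_contra hlt
  push Not at hlt
  have := Int.le_of_dvd (by omega) (hL.dvd_sub x y h)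
  omega

/-- Adding an element of an octant semigroup to a routing that is long enough in the negative
direction. -/
lemma exists_add (hL : HasRoutingLattice M s (lat q) k) {j : Fin 3} {a : Fin 3 → ℤ}
    (ha : a ∈ orthant (lat q) (oneNeg j)) {x : Fin 3 →₀ ℕ} (hx : -a j ≤ x j) :
    ∃ y, toInt y - toInt x = a ∧ y.degree = x.degree ∧ endpoint M s y = endpoint M s x := by
  obtain ⟨haL, h0, h1, h2⟩ := mem_orthant_iff.1 ha
  obtain ⟨y, hy⟩ := exists_toInt_of_nonneg (a := toInt x + a) (by
    rw [forall_fin_three (j := j)]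
    simp only [toInt, Pi.add_apply]
    exact ⟨by linarith, by positivity, by positivity⟩)
  have hya : toInt y - toInt x = a := by rw [hy]; abel
  have hdeg : y.degree = x.degree := by
    have := sum_toInt_sub y x
    rw [hya, haL.2] at this
    omega
  exact ⟨y, hya, hdeg, (hL.endpoint_eq_iff y x hdeg).2 (hya ▸ haL)⟩

/-- A routing n e_j has zero entries off j, so passing to a competitor can only decrease entry j:
the difference falls in S_j. -/
lemma mem_orthant_sub_single (hL : HasRoutingLattice M s (lat q) k) {j : Fin 3} {n : ℕ}
    {y : Fin 3 →₀ ℕ} (hdeg : y.degree = n)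
    (h : endpoint M s y = endpoint M s (Finsupp.single j n)) :
    toInt y - toInt (Finsupp.single j n) ∈ orthant (lat q) (oneNeg j) ∧
      -(n : ℤ) ≤ (toInt y - toInt (Finsupp.single j n)) j := by
  have hmem := (hL.endpoint_eq_iff y (Finsupp.single j n) (by simpa using hdeg)).1 h
  have hle : y j ≤ n := hdeg ▸ Finsupp.le_degree j y
  refine ⟨mem_orthant_iff.2 ⟨hmem, ?_, ?_, ?_⟩, ?_⟩
  · simp [toInt, hle]
  · simp [toInt]
  · simp [toInt]
  · simp [toInt]

/-- A compatible ray separates the cones of two MDD's. -/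
lemma mem_boundaryRays [NeZero M] (hL : HasRoutingLattice M s (lat q) k) {j : Fin 3}
    {a : Fin 3 → ℤ} {w : H0 3} (hw : w ≠ 0) (ha : Compatible (lat q) j w a) (hak : -a j < k) :
    rayOfNeZero ℝ w hw ∈ boundaryRays M s := by
  have hsep := separates_quarterTurn hw
  -- The two orders break ties of w in opposite ways.
  obtain ⟨D, hD⟩ := exists_isMinFor hL.surjective (weightOrder w _ hsep)
  obtain ⟨D', hD'⟩ := exists_isMinFor hL.surjective (weightOrder w _ hsep.neg)
  refine ⟨w, hw, rfl, D, D', fun heq => ?_, hD.mem_closure, hD'.mem_closure⟩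
  subst heq
  have haS := ha.mem_hilbertBasis.1
  obtain ⟨n, hn⟩ : ∃ n : ℕ, (n : ℤ) = -a j :=
    ⟨(-a j).toNat, Int.toNat_of_nonneg (by linarith [(mem_orthant_iff.1 haS).2.1])⟩
  set x : Fin 3 →₀ ℕ := Finsupp.single j n with hx
  set z := D (endpoint M s x) with hz
  have hzend : endpoint M s z = endpoint M s x := hD.endpoint_eq _
  have hxdeg : x.degree = n := by simp [hx]
  have hzx1 := hD.le _ x rfl
  have hzx2 := hD'.le _ x rfl
  have hzdeg : z.degree = x.degree :=
    le_antisymm (degree_le_of_le (isGraded_weightOrder hsep) hzx1)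
      (hL.degree_le hzend.symm (by omega))
  rw [weightOrder_le_iff_of_degree_eq hzdeg] at hzx1 hzx2
  have hnegw : ∀ b : Fin 3 →₀ ℕ, natWeight (-quarterTurn w) b = -natWeight (quarterTurn w) b :=
    fun b => by rw [natWeight_eq, weight_neg_left, natWeight_eq]
  obtain ⟨hbS, hbj⟩ := hL.mem_orthant_sub_single (hzdeg.trans hxdeg) hzend
  have hwb : 0 ≤ weight w (toInt z - toInt x) := by
    apply ha.weight_nonneg _ hbS
    rw [l1_eq_of_mem_orthant hbS, l1_eq_of_mem_orthant haS]
    linarith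
  rw [weight_toInt_sub] at hwb
  -- Compatibility excludes a smaller w-weight, and opposite tie-breakings with one common minimum
  -- force equal u-weights too.
  have hzx : z = x := by
    simp only [hnegw] at hzx2
    have h1 : natWeight w z = natWeight w x := by
      rcases hzx1 with h | h
      · linarith
      · exact h.1
    have h2 : natWeight (quarterTurn w) z = natWeight (quarterTurn w) x := by
      rcases hzx1 with h | h
      · linarith
      rcases hzx2 with h' | h'
      · linarith
      linarith [h.2, h'.2]
    apply weightKey_injective hsep
    rw [weightKey, weightKey, hzdeg, h1, h2]
  -- The routing x + a ties with x under w, hence under both tie-breakings, so separation would give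
  -- a = 0.
  obtain ⟨y, hya, hydeg, hyend⟩ := hL.exists_add haS (x := x) (by simp [hx, hn])
  have hzy1 := hD.le _ y hyend
  have hzy2 := hD'.le _ y hyend
  rw [← hz, hzx] at hzy1 hzy2
  rw [weightOrder_le_iff_of_degree_eq hydeg.symm] at hzy1 hzy2
  simp only [hnegw] at hzy2
  have hwa := ha.orthogonal
  rw [← hya, weight_toInt_sub] at hwa
  apply ha.mem_hilbertBasis.2.1
  rw [← hya]
  refine hsep _ (by rw [hya]; exact haS.1.2) (by rw [weight_toInt_sub, hwa]) ?_
  rw [weight_toInt_sub]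
  rcases hzy1 with h | h
  · linarith
  rcases hzy2 with h' | h'
  · linarith
  linarith [h.2, h'.2]

/-- A weight vector for which two shortest routings to a vertex have the same minimal weight is
compatible with some Hilbert basis element. -/
lemma exists_compatible (hL : HasRoutingLattice M s (lat q) k) {w : H0 3} (hw : w ≠ 0)
    {x y : Fin 3 →₀ ℕ} (hxy : x ≠ y) (hdeg : x.degree = y.degree)
    (hend : endpoint M s x = endpoint M s y)
    (hx : ∀ b, endpoint M s b = endpoint M s x → b.degree = x.degree →
      natWeight w x ≤ natWeight w b)
    (hy : ∀ b, endpoint M s b = endpoint M s y → b.degree = y.degree →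
      natWeight w y ≤ natWeight w b) : ∃ j a, Compatible (lat q) j w a := by
  have hmem := (hL.endpoint_eq_iff x y hdeg).1 hend
  obtain ⟨j, hj⟩ := exists_mem_orthant hmem
  refine ⟨j, ?_⟩
  wlog hS : toInt x - toInt y ∈ orthant (lat q) (oneNeg j) generalizing x y
  · have hS' := hj.resolve_left hS
    rw [neg_sub] at hS'
    exact this hxy.symm hdeg.symm hend.symm hy hx (by rw [← neg_sub]; exact neg_mem hmem)
      (Or.inl hS') hS'
  set f := toInt x - toInt y with hf
  have hf0 : f ≠ 0 := fun h => hxy (toInt_injective (sub_eq_zero.1 h))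
  have hwf : weight w f = 0 := by
    rw [hf, weight_toInt_sub, sub_eq_zero]
    exact le_antisymm (hx y hend.symm hdeg.symm) (hy x hend hdeg)
  let T : Set (Fin 3 → ℤ) := {b | b ∈ lat q ∧ b ≠ 0 ∧ weight w b = 0}
  have hl1 : ∀ b : Fin 3 → ℤ, 0 ≤ l1 b := fun b => Finset.sum_nonneg fun i _ => abs_nonneg _
  obtain ⟨a, haT, hamin⟩ : ∃ a ∈ T, ∀ b ∈ T, l1 a ≤ l1 b := by
    obtain ⟨a, haT, hamin⟩ := WellFounded.has_min
      (InvImage.wf (fun b : Fin 3 → ℤ => (l1 b).toNat) Nat.lt_wfRel.wf) T ⟨f, hmem, hf0, hwf⟩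
    refine ⟨a, haT, fun b hb => ?_⟩
    have := hamin b hb
    simp only [InvImage] at this
    have h' : ¬ (l1 b).toNat < (l1 a).toNat := this
    have := hl1 a
    have := hl1 b
    omega
  obtain ⟨a, ⟨haL, ha0, hwa⟩, hamin, haj⟩ : ∃ a ∈ T, (∀ b ∈ T, l1 a ≤ l1 b) ∧ a j ≤ 0 := by
    rcases exists_pm_nonpos a j with h | h
    · exact ⟨a, haT, hamin, h⟩
    · refine ⟨-a, ⟨neg_mem haT.1, neg_ne_zero.2 haT.2.1, ?_⟩, ?_, h⟩
      · rw [weight_neg, haT.2.2, neg_zero]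
      · rw [l1_neg]; exact hamin
  have haS : a ∈ orthant (lat q) (oneNeg j) :=
    mem_orthant_of_parallel hS hf0 haL
      (mul_eq_mul_of_weight_eq_zero hw hmem.2 haL.2 hwf hwa) haj
  -- As a is no longer than f and -f_j ≤ y_j, the routing y has room for a and for every element of
  -- S_j no longer than a.
  have hya : -a j ≤ y j := by
    have h1 := hamin f ⟨hmem, hf0, hwf⟩
    rw [l1_eq_of_mem_orthant haS, l1_eq_of_mem_orthant hS] at h1
    have h2 : f j = x j - y j := rfl
    omega
  have hnonneg : ∀ b ∈ orthant (lat q) (oneNeg j), l1 b ≤ l1 a → 0 ≤ weight w b := by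
    intro b hb hle
    rw [l1_eq_of_mem_orthant haS, l1_eq_of_mem_orthant hb] at hle
    obtain ⟨z, hzb, hzdeg, hzend⟩ := hL.exists_add hb (x := y) (by linarith)
    have := hy z hzend hzdeg
    rw [← hzb, weight_toInt_sub]
    linarith
  refine ⟨a, hwa, fun b hb hb0 hwb => hamin b ⟨hb, hb0, hwb⟩, ⟨haS, ha0, ?_⟩, hnonneg⟩
  intro b hb c hc habc
  by_contra hcon
  push Not at hcon
  have hjb : a j = b j + c j := by rw [habc]; rfl
  have hb0 := (mem_orthant_iff.1 hb).2.1
  have hc0 := (mem_orthant_iff.1 hc).2.1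
  have hlb : l1 b ≤ l1 a := by
    rw [l1_eq_of_mem_orthant haS, l1_eq_of_mem_orthant hb]; linarith
  have hlc : l1 c ≤ l1 a := by
    rw [l1_eq_of_mem_orthant haS, l1_eq_of_mem_orthant hc]; linarith
  have h1 := hnonneg b hb hlb
  have h2 := hnonneg c hc hlc
  -- Two non-negative weights with sum zero vanish, so b is orthogonal to w and at least as long as
  -- a, leaving c = 0.
  rw [habc, weight_add] at hwa
  have h3 := hamin b ⟨hb.1, hcon.1, by linarith⟩
  rw [l1_eq_of_mem_orthant haS, l1_eq_of_mem_orthant hb] at h3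
  exact hcon.2 (eq_zero_of_mem_orthant hc (by linarith))

lemma boundaryRays_eq [NeZero M] (hL : HasRoutingLattice M s (lat q) k)
    (hq : ¬ (3 : ℤ) ∣ (q : ℤ) - 1) (hk : 1 + q + q ^ 2 < k) :
    boundaryRays M s = {ρ | ∃ j a, ρ ∈ compatibleRays (lat q) j a} := by
  ext ρ
  constructor
  · rintro ⟨w, hw, rfl, D, D', hne, hD, hD'⟩
    obtain ⟨c, hc⟩ := Function.ne_iff.1 hne
    have hM := isMDD_of_mem_closure hD
    have hM' := isMDD_of_mem_closure hD'
    obtain ⟨j, a, h⟩ := hL.exists_compatible hw hc (hM.degree_eq hM' c)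
      ((hM.endpoint_eq c).trans (hM'.endpoint_eq c).symm)
      (fun b hb hdeg => natWeight_le_of_mem_closure hD (hb.trans (hM.endpoint_eq c)) hdeg)
      (fun b hb hdeg => natWeight_le_of_mem_closure hD' (hb.trans (hM'.endpoint_eq c)) hdeg)
    exact ⟨j, a, w, hw, rfl, h⟩
  · rintro ⟨j, a, w, hw, rfl, h⟩
    refine hL.mem_boundaryRays hw h ?_
    have := neg_self_le_of_mem_hilbertBasis hq h.mem_hilbertBasis
    omega

end HasRoutingLattice

end

/-! ### Types of graded orders, and coherent diagrams. -/

section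

section Pos

variable {r : ℕ}

/-- The positive integer vectors of the extension of a monomial order to `ℤ^r`. -/
def Pos (m : MonomialOrder.{0, 0} (Fin r)) (a : Fin r → ℤ) : Prop :=
  ∃ x y : Fin r →₀ ℕ, toInt x - toInt y = a ∧ y ≺[m] x

variable {m : MonomialOrder.{0, 0} (Fin r)}

/-- By cancellation the comparison depends only on the difference, so `Pos` is independent of the
chosen representation. -/
lemma pos_sub_iff {x y : Fin r →₀ ℕ} : Pos m (toInt x - toInt y) ↔ y ≺[m] x := by
  refine ⟨?_, fun h => ⟨x, y, rfl, h⟩⟩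
  rintro ⟨x', y', h, hlt⟩
  have he : x' + y = x + y' := by
    apply toInt_injective
    rw [toInt_add, toInt_add]
    linear_combination h
  have h1 : m.toSyn (y' + y) < m.toSyn (x' + y) := by
    rw [map_add, map_add]
    exact add_lt_add_left hlt _
  rw [he, add_comm, map_add, map_add] at h1
  exact lt_of_add_lt_add_right h1

lemma Pos.add {a b : Fin r → ℤ} (ha : Pos m a) (hb : Pos m b) : Pos m (a + b) := by
  obtain ⟨x, y, rfl, h⟩ := ha
  obtain ⟨x', y', rfl, h'⟩ := hb
  refine ⟨x + x', y + y', ?_, ?_⟩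
  · rw [toInt_add, toInt_add]; abel
  · rw [map_add, map_add]
    exact add_lt_add h h'

lemma Pos.add_nsmul {a b : Fin r → ℤ} (ha : Pos m a) (hb : Pos m b) (n : ℕ) :
    Pos m (a + n • b) := by
  induction n with
  | zero => simpa using ha
  | succ n ih => rw [succ_nsmul, ← add_assoc]; exact ih.add hb

lemma pos_neg_of_not_pos {a : Fin r → ℤ} (h : ¬ Pos m a) (ha : a ≠ 0) : Pos m (-a) := by
  obtain ⟨x, y, rfl⟩ := exists_toInt_sub a
  rw [pos_sub_iff, not_lt] at h
  rw [neg_sub, pos_sub_iff]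
  refine lt_of_le_of_ne h fun he => ha ?_
  rw [m.toSyn.injective he, sub_self]

lemma Pos.not_neg {a : Fin r → ℤ} (h : Pos m a) : ¬ Pos m (-a) := by
  obtain ⟨x, y, rfl⟩ := exists_toInt_sub a
  rw [pos_sub_iff] at h
  rw [neg_sub, pos_sub_iff]
  exact not_lt.2 h.le

lemma pos_weightOrder {w u : H0 r} {h : Separates w u} {a : Fin r → ℤ} (ha : ∑ i, a i = 0)
    (hwa : 0 < weight w a) : Pos (weightOrder w u h) a := by
  obtain ⟨x, y, rfl⟩ := exists_toInt_sub a
  rw [sum_toInt_sub] at ha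
  rw [weight_toInt_sub] at hwa
  have hdeg : x.degree = y.degree := by omega
  rw [pos_sub_iff, ← not_le, weightOrder_le_iff_of_degree_eq hdeg]
  rintro (h | h)
  · linarith
  · linarith [h.1]

end Pos

variable {q : ℕ} {m m' : MonomialOrder.{0, 0} (Fin 3)}

lemma Pos.latVec_add {j : Fin 3} {α β α' β' : ℤ} (h : Pos m (latVec q j α β))
    (h' : Pos m (latVec q j α' β')) {n : ℤ} (hn : 0 ≤ n) :
    Pos m (latVec q j (α + n * α') (β + n * β')) := by
  lift n to ℕ using hn
  have := h.add_nsmul h' n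
  convert this using 1
  have hsmul : n • latVec q j α' β' = latVec q j (n * α') (n * β') := by
    rw [eq_latVec_iff]
    simp only [Pi.smul_apply, latVec_self, latVec_add_one, latVec_add_two, nsmul_eq_mul]
    refine ⟨by ring, by ring, by ring⟩
  rw [hsmul, MultiLoop.latVec_add]

lemma pos_latVec_neg_of_not_pos {j : Fin 3} {α β : ℤ} (h : ¬ Pos m (latVec q j α β))
    (h0 : α ≠ 0 ∨ β ≠ 0) : Pos m (latVec q j (-α) (-β)) := by
  rw [← latVec_neg]
  refine pos_neg_of_not_pos h ?_
  rw [ne_eq, latVec_eq_zero]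
  tauto

lemma Pos.not_latVec_neg {j : Fin 3} {α β : ℤ} (h : Pos m (latVec q j α β)) :
    ¬ Pos m (latVec q j (-α) (-β)) := by
  rw [← latVec_neg]
  exact h.not_neg

lemma latVec_succ_one (j : Fin 3) : latVec q (j + 1) 1 0 = latVec q j 0 1 := by
  rw [latVec_succ]; simp

lemma latVec_add_two_one (j : Fin 3) : latVec q (j + 2) 1 0 = latVec q j (-1) (-1) := by
  rw [← fin_three_add_one_add_one, latVec_succ, latVec_succ]; simp

/-- The combinatorial types `(j, i)` of monomial orders: for `i ≤ q`, the rotations of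
`basisVec q 0` by `j` and `j + 1` are positive and `i` is the number of positive
`rotate j (basisVec q i')` with `0 < i' ≤ q`; for `i = q + 1`, only the rotation of `basisVec q 0`
by `j` is positive. -/
def HasType (q : ℕ) (m : MonomialOrder.{0, 0} (Fin 3)) (j : Fin 3) (i : ℕ) : Prop :=
  if i ≤ q then Pos m (latVec q j 1 0) ∧ Pos m (latVec q (j + 1) 1 0) ∧
    ∀ i' : ℕ, i' ≤ q → (Pos m (latVec q j 1 (-i')) ↔ i' ≤ i)
  else Pos m (latVec q j 1 0) ∧ ¬ Pos m (latVec q (j + 1) 1 0) ∧ ¬ Pos m (latVec q (j + 2) 1 0)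

lemma exists_hasType (q : ℕ) (m : MonomialOrder.{0, 0} (Fin 3)) :
    ∃ j, ∃ i ≤ q + 1, HasType q m j i := by
  have hB : ∀ j, Pos m (latVec q j 1 0) → Pos m (latVec q (j + 1) 1 0) →
      ∃ i ≤ q + 1, HasType q m j i := by
    intro j h0 h1
    classical
    -- Since v_{j+1} is positive, positivity of (1, -i) passes to smaller i, so the largest such i ≤
    -- q describes all of them.
    refine ⟨Nat.findGreatest (fun i => Pos m (latVec q j 1 (-i))) q,
      (Nat.findGreatest_le q).trans (Nat.le_succ q), ?_⟩
    rw [HasType, if_pos (Nat.findGreatest_le q)]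
    refine ⟨h0, h1, fun i' hi' => ⟨fun h => Nat.le_findGreatest hi' h, fun h => ?_⟩⟩
    have hg : Pos m (latVec q j 1
        (-(Nat.findGreatest (fun i : ℕ => Pos m (latVec q j 1 (-i))) q : ℕ))) :=
      Nat.findGreatest_spec (P := fun i : ℕ => Pos m (latVec q j 1 (-i))) (m := 0) (Nat.zero_le q)
        (by simpa using h0)
    set g := Nat.findGreatest (fun i : ℕ => Pos m (latVec q j 1 (-i))) q
    rw [latVec_succ_one] at h1
    have := hg.latVec_add h1 (n := (g : ℤ) - i') (by omega)
    convert this using 2 <;> ring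
  have hA : ∀ j, Pos m (latVec q j 1 0) → ¬ Pos m (latVec q (j + 1) 1 0) →
      ¬ Pos m (latVec q (j + 2) 1 0) → ∃ i ≤ q + 1, HasType q m j i := by
    intro j h0 h1 h2
    exact ⟨q + 1, le_rfl, by rw [HasType, if_neg (by omega)]; exact ⟨h0, h1, h2⟩⟩
  have hnone : ¬ Pos m (latVec q 0 1 0) → ¬ Pos m (latVec q 1 1 0) → Pos m (latVec q 2 1 0) := by
    intro h0 h1
    have e1 := latVec_succ_one (q := q) 0
    have e2 := latVec_add_two_one (q := q) 0
    rw [zero_add] at e1 e2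
    rw [e1] at h1
    rw [e2]
    have h0' := pos_latVec_neg_of_not_pos h0 (by simp)
    have h1' := pos_latVec_neg_of_not_pos h1 (by simp)
    simpa using h0'.latVec_add h1' (n := 1) (by simp)
  by_cases h0 : Pos m (latVec q 0 1 0) <;> by_cases h1 : Pos m (latVec q 1 1 0) <;>
    by_cases h2 : Pos m (latVec q 2 1 0)
  · exact ⟨0, hB 0 h0 h1⟩
  · exact ⟨0, hB 0 h0 h1⟩
  · exact ⟨2, hB 2 h2 h0⟩
  · exact ⟨0, hA 0 h0 h1 h2⟩
  · exact ⟨1, hB 1 h1 h2⟩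
  · exact ⟨1, hA 1 h1 h2 h0⟩
  · exact ⟨2, hA 2 h2 h0 h1⟩
  · exact absurd (hnone h0 h1) h2

/-- On S_l with v_l positive, the type fixes every sign. If v_j and v_{j+1} are positive, only the
(1, -i') of S_j and the vector (q+1, 1) of S_{j+1}, opposite to (1, -q) of S_j, are undecided, and i
decides them. The other elements, and all of S_j when only v_j is positive, are sums of vectors
already known to be positive. -/
lemma HasType.pos_basis_of_pos (hq : ¬ (3 : ℤ) ∣ (q : ℤ) - 1) {j : Fin 3} {i : ℕ}
    (hm : HasType q m j i) (hm' : HasType q m' j i) {l : Fin 3} (hl : Pos m (latVec q l 1 0))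
    {a : Fin 3 → ℤ} (ha : a ∈ hilbertBasis (orthant (lat q) (oneNeg l))) (hpos : Pos m a) :
    Pos m' a := by
  rw [mem_hilbertBasis_iff hq] at ha
  rw [HasType] at hm hm'
  split_ifs at hm hm' with hi
  · obtain ⟨h0, h1, h⟩ := hm
    obtain ⟨h0', h1', h'⟩ := hm'
    obtain rfl | rfl | rfl := fin_three_cases j l
    · rcases ha with ⟨i', hi', rfl⟩ | rfl
      · exact (h' i' hi').2 ((h i' hi').1 hpos)
      · rw [latVec_succ_one] at h1'
        have := h1'.latVec_add h0' (n := (q : ℤ) + 1) (by positivity)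
        convert this using 2 <;> ring
    · rcases ha with ⟨i', hi', rfl⟩ | rfl
      · have e : latVec q j 1 0 = latVec q (j + 1) (-1) (-1) := by
          rw [latVec_succ]; congr 1
        rw [e] at h0'
        have h2 := h1'.latVec_add h0' (n := 1) (by simp)
        have := h1'.latVec_add h2 (n := (i' : ℤ)) (by simp)
        convert this using 2 <;> ring
      · have e : latVec q (j + 1) (q + 1) 1 = latVec q j (-1) (-(-(q : ℤ))) := by
          rw [latVec_succ]; congr 1; ring
        rw [e] at hpos ⊢
        apply pos_latVec_neg_of_not_pos
        · rw [h' q le_rfl, ← h q le_rfl]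
          intro hcon
          exact hcon.not_latVec_neg hpos
        · simp
    · exfalso
      rw [latVec_add_two_one] at hl
      rw [latVec_succ_one] at h1
      have := h0.latVec_add h1 (n := 1) (by simp)
      exact this.not_latVec_neg (by simpa using hl)
  · obtain ⟨h0, h1, h2⟩ := hm
    obtain ⟨h0', h1', h2'⟩ := hm'
    obtain rfl | rfl | rfl := fin_three_cases j l
    · rcases ha with ⟨i', hi', rfl⟩ | rfl
      · rw [latVec_succ_one] at h1'
        have := h0'.latVec_add (pos_latVec_neg_of_not_pos h1' (by simp)) (n := (i' : ℤ)) (by simp)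
        convert this using 2 <;> ring
      · rw [latVec_add_two_one] at h2'
        have := (pos_latVec_neg_of_not_pos h2' (by simp)).latVec_add h0' (n := (q : ℤ)) (by simp)
        convert this using 2 <;> ring
    · exact absurd hl h1
    · exact absurd hl h2

lemma HasType.pos_iff {j : Fin 3} {i : ℕ} (hm : HasType q m j i) (l : Fin 3) :
    Pos m (latVec q l 1 0) ↔ l = j ∨ i ≤ q ∧ l = j + 1 := by
  have hj1 : j + 1 ≠ j := by clear hm; revert j; decide
  have hj2 : j + 2 ≠ j := by clear hm hj1; revert j; decide
  have hj3 : j + 2 ≠ j + 1 := by clear hm hj1 hj2; revert j; decide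
  rw [HasType] at hm
  split_ifs at hm with hi
  · obtain ⟨h0, h1, h⟩ := hm
    obtain rfl | rfl | rfl := fin_three_cases j l
    · simp [h0]
    · simp [h1, hi]
    · simp only [hj2, hj3, and_false, or_self, iff_false]
      intro hl
      rw [latVec_add_two_one] at hl
      rw [latVec_succ_one] at h1
      have := h0.latVec_add h1 (n := 1) (by simp)
      exact this.not_latVec_neg (by simpa using hl)
  · obtain ⟨h0, h1, h2⟩ := hm
    obtain rfl | rfl | rfl := fin_three_cases j l
    · simp [h0]
    · simp [h1, hi]
    · simp [h2, hi, hj2]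

/-- Every non-positive element of an octant dominates a non-positive Hilbert basis element. -/
lemma exists_hilbertBasis_not_pos (hq : ¬ (3 : ℤ) ∣ (q : ℤ) - 1) {j : Fin 3} {a : Fin 3 → ℤ}
    (ha : a ∈ orthant (lat q) (oneNeg j)) (h0 : a ≠ 0) (hpos : ¬ Pos m a) :
    ∃ b ∈ hilbertBasis (orthant (lat q) (oneNeg j)), ¬ Pos m b ∧ a j ≤ b j := by
  -- Positive vectors are closed under addition, so removing a positive basis element leaves a
  -- non-positive remainder with smaller -a_j.
  induction h : (-a j).toNat using Nat.strong_induction_on generalizing a with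
  | _ n ih =>
    subst h
    obtain ⟨b, hb, hb0, hab, hlist⟩ := exists_basis_le hq ha h0
    rw [← mem_hilbertBasis_iff hq] at hlist
    have hjab := (mem_orthant_iff.1 hab).2.1
    simp only [Pi.sub_apply] at hjab
    by_cases hbpos : Pos m b
    · have hab0 : a - b ≠ 0 := fun h => hpos (by rwa [sub_eq_zero.1 h])
      have hbj : b j < 0 := lt_of_not_ge fun h => hb0 (eq_zero_of_mem_orthant hb h)
      obtain ⟨c, hc, hcpos, hle⟩ := ih (-(a - b) j).toNat
        (by simp only [Pi.sub_apply]; omega) hab hab0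
        (fun h => hpos (by simpa using h.add hbpos)) rfl
      exact ⟨c, hc, hcpos, by simp only [Pi.sub_apply] at hle; linarith⟩
    · exact ⟨b, hlist, hbpos, by linarith⟩

variable {M k : ℕ} {s : Fin 3 → ℕ}

namespace HasRoutingLattice

/-- Monomial orders of the same type give the same MDD. -/
lemma eq_of_hasType (hL : HasRoutingLattice M s (lat q) k) (hq : ¬ (3 : ℤ) ∣ (q : ℤ) - 1)
    {j : Fin 3} {i : ℕ} (hm : HasType q m j i) (hm' : HasType q m' j i) (hg : IsGraded m)
    (hg' : IsGraded m') {D D' : ZMod M → (Fin 3 →₀ ℕ)} (hD : IsMinFor M s m D)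
    (hD' : IsMinFor M s m' D') : D = D' := by
  funext c
  by_contra hne
  have hdeg := (hD.isMDD hg).degree_eq (hD'.isMDD hg') c
  have hend := (hD.endpoint_eq c).trans (hD'.endpoint_eq c).symm
  have hmem := (hL.endpoint_eq_iff _ _ hdeg).1 hend
  obtain ⟨l, hl⟩ := exists_mem_orthant hmem
  wlog hS : -(toInt (D c) - toInt (D' c)) ∈ orthant (lat q) (oneNeg l) generalizing m m' D D'
  · have hS' := hl.resolve_right hS
    refine this hm' hm hg' hg hD' hD (Ne.symm hne) hdeg.symm hend.symm ?_ ?_ ?_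
    · rw [← neg_sub]; exact neg_mem hmem
    · right; rwa [neg_sub]
    · rwa [neg_sub]
  rw [neg_sub] at hS
  have hnot : ¬ Pos m' (toInt (D' c) - toInt (D c)) := by
    rw [pos_sub_iff, not_lt]
    exact hD'.le c _ (hD.endpoint_eq c)
  obtain ⟨b, hb, hbpos, hle⟩ := exists_hilbertBasis_not_pos hq hS
    (fun h => hne (toInt_injective (sub_eq_zero.1 h)).symm) hnot
  have hDle : -b l ≤ D c l := by
    have : (toInt (D' c) - toInt (D c)) l = (D' c l : ℤ) - D c l := rfl
    omega
  have hpos : ∀ a ∈ orthant (lat q) (oneNeg l), a ≠ 0 → -a l ≤ D c l → Pos m a := by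
    intro a ha ha0 hal
    obtain ⟨y, hya, -, hyend⟩ := hL.exists_add ha hal
    rw [← hya, pos_sub_iff]
    refine lt_of_le_of_ne (hD.le c y (hyend.trans (hD.endpoint_eq c))) fun h => ha0 ?_
    rw [← hya, m.toSyn.injective h, sub_self]
  -- Room for b in D c is also room for the shortest element v_l; its positivity is what allows the
  -- type to be applied on S_l.
  have hshort : -(latVec q l 1 0) l ≤ -b l := by
    have h1 : latVec q l 1 0 l = -(q + 1 : ℤ) := by rw [latVec_self]; ring
    rw [h1]
    rcases (mem_hilbertBasis_iff hq).1 hb with ⟨i', hi', rfl⟩ | rfl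
    · rw [latVec_self]
      have : (0 : ℤ) ≤ q * i' := by positivity
      linarith
    · rw [latVec_self]
      nlinarith
  have hv : latVec q l 1 0 ∈ hilbertBasis (orthant (lat q) (oneNeg l)) :=
    (mem_hilbertBasis_iff hq).2 (Or.inl ⟨0, Nat.zero_le q, by simp⟩)
  exact hbpos (hm.pos_basis_of_pos hq hm' (hpos _ hv.1 hv.2.1 (hshort.trans hDle)) hb
    (hpos _ hb.1 hb.2.1 hDle))

/-- A routing along a single coordinate direction is the smallest one if and only if the elements
of the octant that can be added to it are positive. -/
lemma apply_single_iff (hL : HasRoutingLattice M s (lat q) k) (hg : IsGraded m)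
    {D : ZMod M → (Fin 3 →₀ ℕ)} (hD : IsMinFor M s m D) {l : Fin 3} {n : ℕ} (hn : n < k) :
    D (endpoint M s (Finsupp.single l n)) = Finsupp.single l n ↔
      ∀ a ∈ orthant (lat q) (oneNeg l), a ≠ 0 → -a l ≤ n → Pos m a := by
  constructor
  · intro h a ha ha0 hal
    obtain ⟨y, hya, -, hyend⟩ := hL.exists_add ha (x := Finsupp.single l n) (by simpa using hal)
    rw [← hya, pos_sub_iff]
    have hle := hD.le _ y hyend
    rw [h] at hle
    refine lt_of_le_of_ne hle fun h => ha0 ?_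
    rw [← hya, m.toSyn.injective h, sub_self]
  · intro h
    by_contra hne
    set z := D (endpoint M s (Finsupp.single l n)) with hz
    have hzend : endpoint M s z = endpoint M s (Finsupp.single l n) := hD.endpoint_eq _
    have hle := hD.le _ (Finsupp.single l n) rfl
    have hzdeg : z.degree = n := by
      apply le_antisymm
      · simpa using degree_le_of_le hg hle
      · simpa using hL.degree_le hzend.symm (by simpa using hn)
    obtain ⟨hS, hj⟩ := hL.mem_orthant_sub_single hzdeg hzend
    have := h _ hS (fun h => hne (toInt_injective (sub_eq_zero.1 h))) (by linarith)
    rw [pos_sub_iff] at this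
    exact absurd this (not_lt.2 hle)

end HasRoutingLattice

lemma forall_pos_short_iff (hq0 : 0 < q) (hq : ¬ (3 : ℤ) ∣ (q : ℤ) - 1) (l : Fin 3) :
    (∀ a ∈ orthant (lat q) (oneNeg l), a ≠ 0 → -a l ≤ (q + 1 : ℕ) → Pos m a) ↔
      Pos m (latVec q l 1 0) := by
  constructor
  · intro h
    refine h _ (by simpa using latVec_one_mem_orthant hq l (Nat.zero_le q)) ?_ ?_
    · rw [ne_eq, latVec_eq_zero]; simp
    · rw [latVec_self]; push_cast; linarith
  · intro h a ha ha0 hal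
    obtain ⟨α, β, rfl⟩ := (mem_lat_iff hq l).1 ha.1
    rw [latVec_mem_orthant_iff hq] at ha
    rw [ne_eq, latVec_eq_zero] at ha0
    have hα := (coeff_pos ha.1 ha.2).resolve_right ha0
    rw [latVec_self] at hal
    push_cast at hal
    have hβ := eq_zero_of_short hq0 hα ha.1 (by linarith)
    have := h.latVec_add h (n := α - 1) (by omega)
    convert this using 2
    · ring
    · rw [hβ]; ring

lemma HasType.forall_pos_iff (hq0 : 0 < q) (hq : ¬ (3 : ℤ) ∣ (q : ℤ) - 1) {j : Fin 3} {n i : ℕ}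
    (hm : HasType q m j n) (hn : n ≤ q) (hi : i ≤ q) :
    (∀ a ∈ orthant (lat q) (oneNeg j), a ≠ 0 → -a j ≤ (q + 1 + i * q : ℕ) → Pos m a) ↔
      i ≤ n := by
  rw [HasType, if_pos hn] at hm
  obtain ⟨h0, h1, h⟩ := hm
  rw [← h i hi]
  constructor
  · intro h
    refine h _ (latVec_one_mem_orthant hq j hi) ?_ ?_
    · rw [ne_eq, latVec_eq_zero]; simp
    · rw [latVec_self]; push_cast; linarith
  · intro hpos a ha ha0 hal
    obtain ⟨α, β, rfl⟩ := (mem_lat_iff hq j).1 ha.1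
    rw [latVec_mem_orthant_iff hq] at ha
    rw [ne_eq, latVec_eq_zero] at ha0
    have hα := (coeff_pos ha.1 ha.2).resolve_right ha0
    rw [latVec_self] at hal
    push_cast at hal
    have hβ := mul_add_nonneg_of_le hq0 i hα (by linarith)
    rw [latVec_succ_one] at h1
    have := (hpos.latVec_add hpos (n := α - 1) (by omega)).latVec_add h1 hβ
    convert this using 2 <;> ring

/-- Used for the set of l with v_l positive: a cyclic interval of length one or two in ℤ/3
determines its starting point. -/
lemma eq_of_cyclic_interval_eq {A B : Prop} {j j' : Fin 3}
    (h : ∀ l, (l = j ∨ A ∧ l = j + 1) ↔ (l = j' ∨ B ∧ l = j' + 1)) : j = j' ∧ (A ↔ B) := by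
  by_cases hA : A <;> by_cases hB : B <;>
    simp only [hA, hB, true_and, false_and, or_false] at h ⊢ <;> revert j j' <;> decide

lemma exists_isGraded_hasType (hq : ¬ (3 : ℤ) ∣ (q : ℤ) - 1) (j : Fin 3) (i : ℕ) :
    ∃ m : MonomialOrder.{0, 0} (Fin 3), IsGraded m ∧ HasType q m j i := by
  have key : ∀ (w : H0 3) (hw : w ≠ 0) (l : Fin 3) (α β : ℤ),
      0 < α * latWeight q w l + β * latWeight q w (l + 1) →
      Pos (weightOrder w _ (separates_quarterTurn hw)) (latVec q l α β) := by
    intro w hw l α β h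
    exact pos_weightOrder (latVec_mem hq l α β).2 (by rwa [weight_latVec])
  have keyneg : ∀ (w : H0 3) (hw : w ≠ 0) (l : Fin 3) (α β : ℤ),
      α * latWeight q w l + β * latWeight q w (l + 1) < 0 →
      ¬ Pos (weightOrder w _ (separates_quarterTurn hw)) (latVec q l α β) := by
    intro w hw l α β h hpos
    refine hpos.not_latVec_neg (key w hw l _ _ ?_)
    push_cast
    linarith
  have hne : ∀ {w : H0 3}, latWeight q w j ≠ 0 → w ≠ 0 := by
    rintro w h rfl
    exact h (latWeight_zero j)
  by_cases hi : i ≤ q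
  -- The ratio i + 1/2 lies strictly between the rays (i, 1) and (i + 1, 1): (1, -i') has weight 2(i
  -- - i') + 1.
  · obtain ⟨w, h0, h1⟩ := exists_latWeight q j (2 * i + 1) 2
    have hw : w ≠ 0 := hne (by rw [h0]; positivity)
    refine ⟨_, isGraded_weightOrder (separates_quarterTurn hw), ?_⟩
    rw [HasType, if_pos hi]
    refine ⟨key w hw _ _ _ ?_, key w hw _ _ _ ?_, fun i' _ => ⟨fun h => ?_, fun h => ?_⟩⟩
    · rw [h0]; push_cast; positivity
    · rw [h1]; simp
    · by_contra hlt
      refine keyneg w hw _ _ _ ?_ h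
      rw [h0, h1]
      have : (i : ℝ) + 1 ≤ i' := by exact_mod_cast (by omega : i + 1 ≤ i')
      push_cast
      linarith
    · apply key w hw
      rw [h0, h1]
      have : (i' : ℝ) ≤ i := by exact_mod_cast h
      push_cast
      linarith
  -- The values on v_j, v_{j+1}, v_{j+2} are 2, -1, -1.
  · obtain ⟨w, h0, h1⟩ := exists_latWeight q j 2 (-1)
    have hw : w ≠ 0 := hne (by rw [h0]; positivity)
    refine ⟨_, isGraded_weightOrder (separates_quarterTurn hw), ?_⟩
    rw [HasType, if_neg hi]
    refine ⟨key w hw _ _ _ ?_, keyneg w hw _ _ _ ?_, keyneg w hw _ _ _ ?_⟩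
    · rw [h0]; simp
    · rw [h1]; simp
    · rw [latWeight_add_two, h0, h1]; norm_num

namespace HasRoutingLattice

/-- The type of a monomial order is determined by its MDD. -/
lemma hasType_unique (hL : HasRoutingLattice M s (lat q) k) (hq0 : 0 < q)
    (hq : ¬ (3 : ℤ) ∣ (q : ℤ) - 1) (hk : 1 + q + q ^ 2 < k) {j j' : Fin 3} {i i' : ℕ}
    (hi : i ≤ q + 1) (hi' : i' ≤ q + 1) (hm : HasType q m j i) (hm' : HasType q m' j' i')
    (hg : IsGraded m) (hg' : IsGraded m') {D : ZMod M → (Fin 3 →₀ ℕ)} (hD : IsMinFor M s m D)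
    (hD' : IsMinFor M s m' D) : j = j' ∧ i = i' := by
  -- The routing (q+1) e_l is just long enough to test the sign of v_l.
  have hpos : ∀ l, (l = j ∨ i ≤ q ∧ l = j + 1) ↔ (l = j' ∨ i' ≤ q ∧ l = j' + 1) := by
    intro l
    rw [← hm.pos_iff l, ← hm'.pos_iff l, ← forall_pos_short_iff hq0 hq,
      ← forall_pos_short_iff hq0 hq, ← hL.apply_single_iff hg hD (by nlinarith),
      ← hL.apply_single_iff hg' hD' (by nlinarith)]
  obtain ⟨rfl, hiff⟩ := eq_of_cyclic_interval_eq hpos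
  refine ⟨rfl, ?_⟩
  by_cases hiq : i ≤ q
  · have hiq' := hiff.1 hiq
    -- The length q + 1 + nq is minus the j-th entry of (1, -n), and is at most N < k.
    have key : ∀ n ≤ q, n ≤ i ↔ n ≤ i' := by
      intro n hn
      have hlt : q + 1 + n * q < k := by nlinarith
      rw [← hm.forall_pos_iff hq0 hq hiq hn, ← hm'.forall_pos_iff hq0 hq hiq' hn,
        ← hL.apply_single_iff hg hD hlt, ← hL.apply_single_iff hg' hD' hlt]
    exact le_antisymm ((key i hiq).1 le_rfl) ((key i' hiq').2 le_rfl)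
  · have : ¬ i' ≤ q := fun h => hiq (hiff.2 h)
    omega

lemma ncard_coherent (hL : HasRoutingLattice M s (lat q) k) (hq0 : 0 < q)
    (hq : ¬ (3 : ℤ) ∣ (q : ℤ) - 1) (hk : 1 + q + q ^ 2 < k) :
    {D | IsCoherentMDD M s D}.ncard = 3 * (q + 2) := by
  choose m hg hm using fun x : Fin 3 × Fin (q + 2) => exists_isGraded_hasType hq x.1 x.2
  choose D hD using fun x => exists_isMinFor hL.surjective (m x)
  have hrange : {D | IsCoherentMDD M s D} = Set.range D := by
    ext D'
    rw [Set.mem_ofPred_eq, isCoherentMDD_iff]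
    constructor
    · rintro ⟨m', hg', hD'⟩
      obtain ⟨j, i, hi, hm'⟩ := exists_hasType q m'
      exact ⟨(j, ⟨i, by omega⟩),
        hL.eq_of_hasType hq (hm (j, ⟨i, by omega⟩)) hm' (hg _) hg' (hD _) hD'⟩
    · rintro ⟨x, rfl⟩
      exact ⟨m x, hg x, hD x⟩
  rw [hrange, ← Set.image_univ, Set.ncard_image_of_injective, Set.ncard_univ]
  · simp
  · rintro ⟨j, i, hi⟩ ⟨j', i', hi'⟩ h
    obtain ⟨rfl, h'⟩ := hL.hasType_unique hq0 hq hk (by simp; omega) (by simp; omega)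
      (hm (j, ⟨i, hi⟩)) (hm (j', ⟨i', hi'⟩)) (hg _) (hg _) (hD _) (h ▸ hD (j', ⟨i', hi'⟩))
    simp only at h'
    subst h'
    rfl

end HasRoutingLattice

end

end MultiLoop

end

/-! ### The theorem. -/

open MultiLoop in
theorem theorem5p2 :
    (∀ q : ℕ, 0 < q → ¬ (3 : ℤ) ∣ (q : ℤ) - 1 →
      ∀ (N : ℕ) (L : AddSubgroup (Fin 3 → ℤ)), N = 1 + q + q ^ 2 →
        L = homLattice N ![1, q, q ^ 2] →
      -- the homogeneous lattice is invariant under cyclic permutations of the coordinates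
      (∀ (j : Fin 3) (a : Fin 3 → ℤ), rotate j a ∈ L ↔ a ∈ L) ∧
      -- the Hilbert bases of the three octants
      (∀ j : Fin 3, hilbertBasis (orthant L (oneNeg j)) = rotate j '' basisList q ∧
        (hilbertBasis (orthant L (oneNeg j))).ncard = q + 2) ∧
      -- each Hilbert basis element but the shortest one has exactly one ray
      (∀ j : Fin 3, ∀ a ∈ hilbertBasis (orthant L (oneNeg j)),
        a ≠ rotate j (basisVec q 0) → ∃! ρ, ρ ∈ compatibleRays L j a) ∧
      -- the shortest one has exactly two, opposite to each other
      (∀ j : Fin 3, ∃ ρ : Module.Ray ℝ (H0 3),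
        compatibleRays L j (rotate j (basisVec q 0)) = {ρ, -ρ} ∧ ρ ≠ -ρ) ∧
      -- there are `3 (q + 2)` different rays altogether
      {ρ | ∃ j a, ρ ∈ compatibleRays L j a}.ncard = 3 * (q + 2) ∧
      -- the networks with exactly `3 (q + 2)` coherent MDD's, and the rays of their fans
      ∀ k t : ℕ, N < k → Nat.gcd t k = 1 → Nat.gcd k N = 1 →
        boundaryRays (N * k) ![t + k, t + q * k, t + q ^ 2 * k] =
          {ρ | ∃ j a, ρ ∈ compatibleRays L j a} ∧
        {D | IsCoherentMDD (N * k) ![t + k, t + q * k, t + q ^ 2 * k] D}.ncard = 3 * (q + 2)) ∧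
    -- the number of MDD's of a triple-loop network is unbounded
    ∀ B : ℕ, ∃ (N : ℕ) (s : Fin 3 → ℕ), 0 < N ∧ (∀ i, 0 < s i) ∧ B ≤ {D | IsMDD N s D}.ncard := by
  refine ⟨?_, ?_⟩
  · rintro q hq0 hq N L rfl rfl
    refine ⟨rotate_mem_lat_iff hq, fun j => ⟨hilbertBasis_eq hq j, ncard_hilbertBasis hq j⟩,
      ?_, ?_, ncard_setOf_compatible hq0 hq, ?_⟩
    · intro j a ha hne
      rw [rotate_basisVec] at hne
      rcases (mem_hilbertBasis_iff hq).1 ha with ⟨i, hi, rfl⟩ | rfl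
      · have hi0 : 0 < i := Nat.pos_of_ne_zero fun h => hne (by rw [h])
        rw [compatibleRays_latVec_one hq0 hq j hi hi0]
        exact ⟨_, rfl, fun _ h => h⟩
      · rw [compatibleRays_long hq j]
        exact ⟨_, rfl, fun _ h => h⟩
    · intro j
      refine ⟨ray q j 0, ?_, Module.Ray.ne_neg_self _⟩
      rw [rotate_basisVec, Nat.cast_zero, neg_zero, compatibleRays_short hq0 hq, neg_ray_zero]
    · intro k t hk htk _
      have hL := hasRoutingLattice hq (by omega) htk
      have : NeZero ((1 + q + q ^ 2) * k) := ⟨Nat.mul_ne_zero (by omega) (by omega)⟩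
      exact ⟨hL.boundaryRays_eq hq hk, hL.ncard_coherent hq0 hq hk⟩
  · intro B
    -- Then q - 1 = 3B + 1 is prime to 3, and 3(q + 2) = 9B + 12 exceeds B.
    set q := 3 * B + 2 with hqB
    have hq : ¬ (3 : ℤ) ∣ (q : ℤ) - 1 := by omega
    set N := 1 + q + q ^ 2
    have hL := hasRoutingLattice (q := q) (k := N + 1) (t := 1) hq (Nat.succ_pos _) (by simp)
    have : NeZero (N * (N + 1)) := ⟨Nat.mul_ne_zero (by omega) (by omega)⟩
    refine ⟨N * (N + 1), ![1 + (N + 1), 1 + q * (N + 1), 1 + q ^ 2 * (N + 1)],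
      Nat.pos_of_ne_zero (NeZero.ne _), ?_, ?_⟩
    · rw [forall_fin_three (j := 0)]
      refine ⟨?_, ?_, ?_⟩ <;> simp
    · have hcard := hL.ncard_coherent (by omega) hq (Nat.lt_succ_self _)
      have hsub := Set.ncard_le_ncard (fun D (hD : IsCoherentMDD _ _ D) => hD.1)
        (finite_setOf_isMDD (N * (N + 1)) ![1 + (N + 1), 1 + q * (N + 1), 1 + q ^ 2 * (N + 1)])
      exact le_trans (by omega) (hcard.symm.le.trans hsub)
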